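/- Let $p$ be a prime and let $K$ be a local field of characteristic $p$, i.e. a field complete with respect to a normalized discrete valuation $v_K:K\to\mathbb Z\cup\{\infty\}$, with perfect residue field $\mathbb F$; we regard $\mathbb F$ as a subfield of $K$, so that $K\cong\mathbb F((t))$. Let $L/K$ be a totally ramified Galois extension with $\mathrm{Gal}(L/K)\cong C_p^n$ and a single (lower) ramification break $b>0$, and let $v_L$ be the normalized valuation of $L$. *Artin–Schreier data* for $L/K$ is a triple $(\beta,\vec\omega,\vec\epsilon)$ with $\beta\in K$, $v_K(\beta)=-b$; with $\omega_1,\dots,\omega_n\in\mathbb F$ linearly independent over $\mathbb F_p$; and with $\epsilon_1,\dots,\epsilon_n\in K$ such that $v_K(\epsilon_i)>-b$ and either $v_K(\epsilon_i)<0$, $p\nmid v_K(\epsilon_i)$, or $\epsilon_i\in\mathbb F$; such that $L$ is generated over $K$ by roots of the polynomials $X^p-X-\omega_i^{p^n}\beta-\epsilon_i$, $1\le i\le n$. Let $M$ be a field with $K\subseteq M\subseteq L$ and $[L:M]=p^m$, $m\ge 1$. For $w\in\mathbb Z$ and $0\le j<m$ let $\mathfrak a(w)_{(j)}\in\{0,\dots,p-1\}$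 be the base-$p$ digits of the representative in $[0,p^m)$ of the class $-b^{-1}w\in\mathbb Z/p^m\mathbb Z$ (here $p\nmid b$). A *Galois scaffold for $L/M$ with infinite precision* consists of elements $\lambda_w\in L$ ($w\in\mathbb Z$) and $\Psi_1,\dots,\Psi_m\in M[\mathrm{Gal}(L/M)]$ such that: (i) $v_L(\lambda_w)=w$ for all $w$; (ii) $\lambda_{w_1}\lambda_{w_2}^{-1}\in M$ whenever $w_1\equiv w_2\pmod{p^m}$; (iii) $\Psi_i\cdot 1=0$ for all $i$; (iv) for all $i$ and $w$ there is $u_{iw}\in\mathcal O_M^\times$ with $\Psi_i(\lambda_w)=u_{iw}\lambda_{w+p^{m-i}b}$ if $\mathfrak a(w)_{(m-i)}\ge1$, and $\Psi_i(\lambda_w)=0$ if $\mathfrak a(w)_{(m-i)}=0$. For a finite elementary abelian $p$-group $H$ let $A$ be the augmentation ideal of $R=\mathbb F[H]$. The group $(1+A)/(1+A^p)\subseteq (R/A^p)^\times$ is an $\mathbb F$-vector space, with scalar multiplication given by the truncated powers $\gamma^{[\omega]}=\sum_{i=0}^{p-1}\binom{\omega}{i}(\gamma-1)^i$, where $\binom{\omega}{i}=\omega(\omega-1)\cdots(\omega-i+1)/i!$.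 Let $\overline H^{[\mathbb F]}$ denote the $\mathbb F$-span in it of the image of $H$. **Proposition.** Let $1\le r\le n-1$, and assume that $(\beta,\vec\omega,\vec\epsilon)$ is Artin–Schreier data for $L/K$ such that $v_K(\epsilon_i)>-b/p^{\,n-1-r}$ for $1\le i\le n$. For $1\le i\le r$ let $x_i\in L$ satisfy $x_i^p-x_i=\omega_i^{p^n}\beta+\epsilon_i$, and set $K_r=K(x_1,\dots,x_r)$, $G_r=\mathrm{Gal}(L/K_r)$, $R_r=\mathbb F[G_r]$, with augmentation ideal $A_r\subseteq R_r$. Then $L/K_r$ has a Galois scaffold with infinite precision $(\{\lambda_w\}_{w\in\mathbb Z},\{\Psi_i\}_{r+1\le i\le n})$ (the $n-r$ elements required by the definition, $\Psi_{r+j}$ being the $j$-th one) such that, for $r+1\le i\le n$, $\Psi_i\in R_r$ and the image of $1+\Psi_i$ in $R_r/A_r^p$ lies in $\overline{G_r}^{[\mathbb F]}$. -/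

import Mathlib

noncomputable section

namespace AS

/-- `v : K → ℤ ∪ {∞}` is a normalized discrete valuation for which `K` is complete, and
`F → K` identifies the field `F` with the residue field of `K`. For perfect `F` and `char K = p`
this says that `K` is a local field of characteristic `p` with residue field `F`, viewed inside
`K` as usual (so that `K ≅ F((t))`). -/
structure IsLocalField (F : Type*) {K : Type*} [Field F] [Field K] [Algebra F K]
    (v : AddValuation K (WithTop ℤ)) : Prop where
  normalized : ∀ m : ℤ, ∃ x : K, v x = (m : WithTop ℤ)
  complete : ∀ a : ℕ → K,
    (∀ N : ℤ, ∃ M : ℕ, ∀ i ≥ M, ∀ j ≥ M, (N : WithTop ℤ) ≤ v (a i - a j)) →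
    ∃ l : K, ∀ N : ℤ, ∃ M : ℕ, ∀ i ≥ M, (N : WithTop ℤ) ≤ v (a i - l)
  const_integral : ∀ c : F, 0 ≤ v (algebraMap F K c)
  residue_surjective : ∀ x : K, 0 ≤ v x → ∃ c : F, 0 < v (x - algebraMap F K c)

/-- `vL` is a normalized discrete valuation on `L` extending `vK` with ramification index
`[L : K]`, i.e. `L / K` is totally ramified. When `K` is complete, `vL` is unique. -/
structure IsTotallyRamified {K L : Type*} [Field K] [Field L] [Algebra K L]
    (vK : AddValuation K (WithTop ℤ)) (vL : AddValuation L (WithTop ℤ)) : Prop where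
  normalized : ∀ m : ℤ, ∃ x : L, vL x = (m : WithTop ℤ)
  extends_base : ∀ x : K, vL (algebraMap K L x) = Module.finrank K L • vK x

/-- The lower ramification group `G_i` of `L / K`, as a set. -/
def lowerRamificationGroup (K : Type*) {L : Type*} [Field K] [Field L] [Algebra K L]
    (vL : AddValuation L (WithTop ℤ)) (i : ℤ) : Set Gal(L/K) :=
  {σ | ∀ x : L, 0 ≤ vL x → ((i + 1 : ℤ) : WithTop ℤ) ≤ vL (σ x - x)}

/-- The set of (lower) ramification breaks of `L / K`. -/
def ramificationBreaks (K : Type*) {L : Type*} [Field K] [Field L] [Algebra K L]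
    (vL : AddValuation L (WithTop ℤ)) : Set ℤ :=
  {i | -1 ≤ i ∧ lowerRamificationGroup K vL i ≠ lowerRamificationGroup K vL (i + 1)}

/-- The constant `ω_i ^ (p ^ n) * β + ε_i` of the `i`-th Artin–Schreier equation. -/
def asConst (p : ℕ) {n : ℕ} {F K : Type*} [Field F] [Field K] [Algebra F K]
    (β : K) (ω : Fin n → F) (ε : Fin n → K) (i : Fin n) : K :=
  algebraMap F K (ω i) ^ p ^ n * β + ε i

/-- `(β, ω, ε)` is Artin–Schreier data for the `C_p ^ n`-extension `L / K` with single
ramification break `b`. -/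
structure IsArtinSchreierData (p b : ℕ) {n : ℕ} {F K : Type*} (L : Type*)
    [Field F] [Field K] [Field L] [Algebra F K] [Algebra K L] [Algebra (ZMod p) F]
    (vK : AddValuation K (WithTop ℤ))
    (β : K) (ω : Fin n → F) (ε : Fin n → K) : Prop where
  val_beta : vK β = ((-(b : ℤ) : ℤ) : WithTop ℤ)
  val_eps : ∀ i, ((-(b : ℤ) : ℤ) : WithTop ℤ) < vK (ε i)
  eps_reduced : ∀ i, (∃ m : ℤ, vK (ε i) = (m : WithTop ℤ) ∧ m < 0 ∧ ¬ (p : ℤ) ∣ m) ∨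
    ∃ c : F, ε i = algebraMap F K c
  linearIndependent : LinearIndependent (ZMod p) ω
  generates : ∃ x : Fin n → L,
    (∀ i, x i ^ p - x i = algebraMap K L (asConst p β ω ε i)) ∧
    IntermediateField.adjoin K (Set.range x) = ⊤

/-- The element `γ(x)`, for `γ` in the group ring `M[Gal(L/M)]` and `x : L`. -/
def groupRingAct {M L : Type*} [Field M] [Field L] [Algebra M L]
    (γ : MonoidAlgebra M Gal(L/M)) (x : L) : L :=
  MonoidAlgebra.lift M (Module.End M L) Gal(L/M) (AlgEquiv.toLinearMapHom M L) γ x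

/-- The digit `𝔞(w)_(j)`: the coefficient of `p ^ j` in the base `p` expansion of the
representative in `[0, p ^ m)` of `-b⁻¹ w ∈ ℤ / p ^ m ℤ`. -/
def digit (p b m : ℕ) (w : ℤ) (j : ℕ) : ℕ :=
  (-(b : ZMod (p ^ m))⁻¹ * (w : ZMod (p ^ m))).val / p ^ j % p

/-- A Galois scaffold with infinite precision for the totally ramified `C_p ^ m`-extension
`L / M` with single ramification break `b`. The index set `{1, …, m}` is replaced by
`Fin m = {0, …, m - 1}`, so that `m - i` becomes `m - 1 - i`. As `vL` extends the valuation of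
`M` up to a positive factor, `vL u = 0` says that `u` is a unit of `𝓞_M`. -/
structure IsGaloisScaffold (p b m : ℕ) {M L : Type*} [Field M] [Field L] [Algebra M L]
    (vL : AddValuation L (WithTop ℤ))
    (lam : ℤ → L) (Ψ : Fin m → MonoidAlgebra M Gal(L/M)) : Prop where
  val_lam : ∀ w : ℤ, vL (lam w) = (w : WithTop ℤ)
  ratio_mem : ∀ w₁ w₂ : ℤ, w₁ ≡ w₂ [ZMOD ((p ^ m : ℕ) : ℤ)] →
    ∃ c : M, lam w₁ * (lam w₂)⁻¹ = algebraMap M L c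
  act_one : ∀ i, groupRingAct (Ψ i) 1 = 0
  act_lam : ∀ (i : Fin m) (w : ℤ), ∃ u : M, vL (algebraMap M L u) = 0 ∧
    groupRingAct (Ψ i) (lam w) =
      if 1 ≤ digit p b m w (m - 1 - i) then
        algebraMap M L u * lam (w + ((p ^ (m - 1 - (i : ℕ)) * b : ℕ) : ℤ))
      else 0

/-- The augmentation ideal of the group ring `F[G]`. -/
def augIdeal (F G : Type*) [Field F] [Group G] : Ideal (MonoidAlgebra F G) :=
  RingHom.ker (MonoidAlgebra.lift F F G (1 : G →* F))

instance (F G : Type*) [Field F] [Group G] : (augIdeal F G).IsTwoSided :=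
  inferInstanceAs (RingHom.ker (MonoidAlgebra.lift F F G (1 : G →* F))).IsTwoSided

/-- The binomial coefficient `ω (ω - 1) ⋯ (ω - (i - 1)) / i!`, used for `i < p` only. -/
def binom {F : Type*} [Field F] (ω : F) (i : ℕ) : F :=
  (∏ j ∈ Finset.range i, (ω - (j : F))) / (i.factorial : F)

/-- The truncated power `γ ^ [ω] = ∑_{i < p} binom(ω, i) (γ - 1) ^ i`. -/
def truncPow (p : ℕ) {F R : Type*} [Field F] [Ring R] [Algebra F R] (γ : R) (ω : F) : R :=
  ∑ i ∈ Finset.range p, binom ω i • (γ - 1) ^ i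

/-- The span `Ḡ^[F]` of the image `Ḡ` of `G` in `(1 + A) / (1 + A ^ k) ⊆ F[G] / A ^ k`. In that
vector space the addition is multiplication of classes and the scalar multiplication is
truncated exponentiation, so the span is the smallest subset that contains the image of `G` and
is stable under products and truncated powers. -/
inductive InTruncSpan (p k : ℕ) (F G : Type*) [Field F] [Group G] :
    MonoidAlgebra F G ⧸ augIdeal F G ^ k → Prop
  | of (g : G) : InTruncSpan p k F G
      (Ideal.Quotient.mk (augIdeal F G ^ k) (MonoidAlgebra.of F G g))
  | mul {γ δ : MonoidAlgebra F G ⧸ augIdeal F G ^ k} :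
      InTruncSpan p k F G γ → InTruncSpan p k F G δ → InTruncSpan p k F G (γ * δ)
  | pow {γ : MonoidAlgebra F G ⧸ augIdeal F G ^ k} (ω : F) :
      InTruncSpan p k F G γ → InTruncSpan p k F G (truncPow p γ ω)

end AS

end

/-!
The extension `L / K` is the top of a tower of stages `stage σ e`, the fields fixed by `σ i` for
`i ≥ e`, where `σ i` translates the `i`-th Artin–Schreier generator `x i` by `1` and fixes the
others (`exists_dual_automorphisms`); the field `K_r` is the stage `r`. A scaffold over `K_r` comes
from elements `X_j = ∑_{i ≤ j} c_{ji} x_i - κ_j`, for `r ≤ j < n`, with constants `c_{ji}`,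
`c_{jj} = 1` and `κ_j ∈ K_r`, whose valuations are `-p ^ (n - 1 - j) b`.

Given such elements, products of binomial coefficients `binom (X_j, a_j)` with `a_j < p`, scaled by
elements of `K_r`, have all integers as valuations, the `a_j` being the digits of the valuation.
The `σ i` translate the `X_j` by a unitriangular matrix of constants. A group ring element that
translates only `X_j`, and by `1`, has truncated powers that translate it by an arbitrary constant,
because the degree in `X_j` is below `p` (`ActsAsTranslation.truncPow`). Starting from the last
variable, each `σ i` can therefore be corrected by truncated powers to a translation `1 + Ψ` of a
single variable (`isRealizable_single`), and `Ψ` lowers one digit by one, exactly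
(`exists_scaffold`).

To find `X_j` when `r ≤ n - 2`, take for `c_j` the solution of a linear system whose matrix is a
Moore matrix (`exists_coeffs`). Then in the `p ^ (j + 1)`-th power of `∑ c_{ji} x_i` only one
multiple of `β` survives (`combination_pow`), besides Frobenius powers of constant combinations of
the `ε_i`. Small Frobenius powers are negligible by the hypothesis on `ε`. The others are removed by
`κ_j`, which requires approximate `p ^ e`-th roots, in the stage `e`, of elements of `K`, up to
integral elements. These exist (`IsTower.exists_root`) because an element of a stage is a sum of
norms from the next stage up to integral elements, and a norm `∏ τ κ` is close to `κ ^ p` as soon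
as every automorphism moves the elements of the stage by a relative amount of at least the break
(`StageGain`). The latter property is proved along with the construction of the `X_j`: an element
`X_j` whose valuation is prime to `p` in its stage and which is moved by integral elements only
determines the displacement of all elements of this stage (`IsTower.stageGain_succ`).

When `r = n - 1` only one element is needed, and it is found by subtracting elements of `K_r` from
`x_{n-1}` as long as the valuation is divisible by `p`; the break of `L / K` forces this to stop
at `-b` (`IsTower.exists_generator_last`).
-/

namespace AS

/-! ### Discrete valuations with constants -/

section Valuation

variable {L : Type*} [Field L] (v : AddValuation L (WithTop ℤ))

lemma exists_val_eq {x : L} (hx : x ≠ 0) : ∃ k : ℤ, v x = (k : WithTop ℤ) := by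
  have h := (v.ne_top_iff (x := x)).2 hx
  exact ⟨(v x).untop h, (WithTop.coe_untop _ h).symm⟩

lemma ne_zero_of_val_eq {x : L} {k : ℤ} (h : v x = (k : WithTop ℤ)) : x ≠ 0 := by
  rw [← v.ne_top_iff, h]; exact WithTop.coe_ne_top

lemma val_mul_eq {x y : L} {k l : ℤ} (hx : v x = (k : WithTop ℤ)) (hy : v y = (l : WithTop ℤ)) :
    v (x * y) = ((k + l : ℤ) : WithTop ℤ) := by
  rw [v.map_mul, hx, hy]; rfl

lemma le_val_mul {x y : L} {k l : ℤ} (hx : (k : WithTop ℤ) ≤ v x) (hy : (l : WithTop ℤ) ≤ v y) :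
    ((k + l : ℤ) : WithTop ℤ) ≤ v (x * y) := by
  rw [v.map_mul]; exact add_le_add hx hy

lemma nsmul_coe (n : ℕ) (k : ℤ) : n • (k : WithTop ℤ) = ((n * k : ℤ) : WithTop ℤ) := by
  rw [← WithTop.coe_nsmul, nsmul_eq_mul]

lemma val_pow_eq {x : L} {k : ℤ} (hx : v x = (k : WithTop ℤ)) (n : ℕ) :
    v (x ^ n) = ((n * k : ℤ) : WithTop ℤ) := by
  rw [v.map_pow, hx, nsmul_coe]

lemma le_val_pow {x : L} {k : ℤ} (hx : (k : WithTop ℤ) ≤ v x) (n : ℕ) :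
    ((n * k : ℤ) : WithTop ℤ) ≤ v (x ^ n) := by
  rw [v.map_pow, ← nsmul_coe]; exact nsmul_le_nsmul_right hx n

lemma val_inv_eq {x : L} {k : ℤ} (hx : v x = (k : WithTop ℤ)) :
    v x⁻¹ = ((-k : ℤ) : WithTop ℤ) := by
  obtain ⟨l, hl⟩ := exists_val_eq v (inv_ne_zero (ne_zero_of_val_eq v hx))
  have h := val_mul_eq v hx hl
  rw [mul_inv_cancel₀ (ne_zero_of_val_eq v hx), v.map_one] at h
  have h' : (0 : ℤ) = k + l := by exact_mod_cast h
  rw [hl]; congr 1; omega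

lemma val_div_eq {x y : L} {k l : ℤ} (hx : v x = (k : WithTop ℤ)) (hy : v y = (l : WithTop ℤ)) :
    v (x / y) = ((k - l : ℤ) : WithTop ℤ) := by
  rw [div_eq_mul_inv, sub_eq_add_neg]
  exact val_mul_eq v hx (val_inv_eq v hy)

lemma le_val_of_pow {x : L} {n : ℕ} (hn : 0 < n) {k : ℤ}
    (h : ((n * k : ℤ) : WithTop ℤ) ≤ v (x ^ n)) : (k : WithTop ℤ) ≤ v x := by
  by_cases hx : x = 0
  · simp [hx]
  obtain ⟨l, hl⟩ := exists_val_eq v hx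
  rw [val_pow_eq v hl, WithTop.coe_le_coe] at h
  rw [hl, WithTop.coe_le_coe]
  exact le_of_mul_le_mul_left h (by exact_mod_cast hn)

lemma val_eq_of_pow {x : L} {n : ℕ} (hn : 0 < n) {k : ℤ}
    (h : v (x ^ n) = ((n * k : ℤ) : WithTop ℤ)) : v x = (k : WithTop ℤ) := by
  have hx : x ≠ 0 := fun hx => ne_zero_of_val_eq v h (by simp [hx, hn.ne'])
  obtain ⟨l, hl⟩ := exists_val_eq v hx
  rw [val_pow_eq v hl, WithTop.coe_inj] at h
  rw [hl, WithTop.coe_inj]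
  exact mul_left_cancel₀ (by exact_mod_cast hn.ne') h

lemma lt_iff_succ_le (k : ℤ) (a : WithTop ℤ) :
    (k : WithTop ℤ) < a ↔ ((k + 1 : ℤ) : WithTop ℤ) ≤ a := by
  induction a with
  | top => simp
  | coe a => norm_cast

lemma zero_lt_iff_one_le (a : WithTop ℤ) : 0 < a ↔ ((1 : ℤ) : WithTop ℤ) ≤ a :=
  lt_iff_succ_le 0 a

lemma val_natCast_nonneg (n : ℕ) : ((0 : ℤ) : WithTop ℤ) ≤ v (n : L) := by
  induction n with
  | zero => simp
  | succ n ih =>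
    rw [Nat.cast_succ]
    exact v.map_le_add ih (by simp)

lemma val_add_eq_left {x y : L} {k : ℤ} (hx : v x = (k : WithTop ℤ))
    (hy : ((k + 1 : ℤ) : WithTop ℤ) ≤ v y) : v (x + y) = (k : WithTop ℤ) := by
  rw [v.map_add_eq_of_lt_left, hx]
  rwa [hx, lt_iff_succ_le]

lemma le_val_of_le {x : L} {k l : ℤ} (hx : (k : WithTop ℤ) ≤ v x) (h : l ≤ k) :
    (l : WithTop ℤ) ≤ v x :=
  le_trans (WithTop.coe_le_coe.2 h) hx

lemma le_val_of_val_eq {x : L} {k l : ℤ} (hx : v x = (k : WithTop ℤ)) (h : l ≤ k) :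
    (l : WithTop ℤ) ≤ v x := by
  rw [hx]; exact WithTop.coe_le_coe.2 h

lemma val_eq_congr {x : L} {k l : ℤ} (hx : v x = (k : WithTop ℤ)) (h : k = l) :
    v x = (l : WithTop ℤ) := h ▸ hx

/-- Induction on the valuation: a property of the elements of `D` that holds above the level `T`
holds on all of `D` if elements below `T` can be reduced to elements of larger valuation. -/
lemma induction_on_val (D P : L → Prop) (T : ℤ)
    (high : ∀ z, D z → (T : WithTop ℤ) ≤ v z → P z)
    (step : ∀ (k : ℤ) (z : L), k < T → D z → v z = (k : WithTop ℤ) →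
      P z ∨ ∃ z', D z' ∧ ((k + 1 : ℤ) : WithTop ℤ) ≤ v z' ∧ (P z' → P z)) :
    ∀ z, D z → P z := by
  have key : ∀ (d : ℕ) (z : L), D z → ((T - d : ℤ) : WithTop ℤ) ≤ v z → P z := by
    intro d
    induction d with
    | zero => intro z hz h; exact high z hz (by simpa using h)
    | succ d ih =>
      intro z hz h
      by_cases hT : ((T - d : ℤ) : WithTop ℤ) ≤ v z
      · exact ih z hz hT
      · have hz0 : z ≠ 0 := by rintro rfl; simp at hT
        obtain ⟨k, hk⟩ := exists_val_eq v hz0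
        rw [hk, WithTop.coe_le_coe] at hT
        rw [hk, WithTop.coe_le_coe] at h
        obtain hPz | ⟨z', hz', hkz, hP⟩ := step k z (by omega) hz hk
        · exact hPz
        exact hP (ih z' hz' (le_val_of_le v hkz (by push_cast at h; omega)))
  intro z hz
  by_cases hz0 : z = 0
  · exact high z hz (by simp [hz0])
  obtain ⟨k, hk⟩ := exists_val_eq v hz0
  exact key (T - k).toNat z hz (by rw [hk, WithTop.coe_le_coe]; omega)

variable (F : Type*) [Field F] [Algebra F L]

/-- `F ⊆ L` is a field of representatives for the residue field of `v`. -/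
structure IsConstField : Prop where
  const_integral : ∀ c : F, 0 ≤ v (algebraMap F L c)
  residue_surjective : ∀ x : L, 0 ≤ v x → ∃ c : F, 0 < v (x - algebraMap F L c)

variable {v F}

lemma IsConstField.val_const (h : IsConstField v F) {c : F} (hc : c ≠ 0) :
    v (algebraMap F L c) = ((0 : ℤ) : WithTop ℤ) := by
  have hc' : algebraMap F L c ≠ 0 := by simpa using hc
  obtain ⟨k, hk⟩ := exists_val_eq v hc'
  have h1 := h.const_integral c
  have h2 := h.const_integral c⁻¹
  rw [map_inv₀, val_inv_eq v hk] at h2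
  rw [hk] at h1 ⊢
  have h1' : 0 ≤ k := by exact_mod_cast h1
  have h2' : 0 ≤ -k := by exact_mod_cast h2
  congr 1; omega

lemma IsConstField.le_val_const (h : IsConstField v F) (c : F) :
    ((0 : ℤ) : WithTop ℤ) ≤ v (algebraMap F L c) := h.const_integral c

lemma IsConstField.exists_leading (h : IsConstField v F) {z g : L} {k : ℤ}
    (hz : v z = (k : WithTop ℤ)) (hg : v g = (k : WithTop ℤ)) :
    ∃ c : F, ((k + 1 : ℤ) : WithTop ℤ) ≤ v (z - algebraMap F L c * g) := by
  have hq := val_div_eq v hz hg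
  obtain ⟨c, hc⟩ := h.residue_surjective (z / g) (by rw [hq, sub_self]; rfl)
  refine ⟨c, ?_⟩
  rw [zero_lt_iff_one_le] at hc
  have h2 := le_val_mul v hg.ge hc
  have hg0 := ne_zero_of_val_eq v hg
  convert h2 using 2
  field_simp

end Valuation

/-! ### Automorphisms that raise the valuation -/

section Gain

variable {F K L : Type*} [Field F] [Field K] [Field L] [Algebra F K] [Algebra K L] [Algebra F L]
  [IsScalarTower F K L] (v : AddValuation L (WithTop ℤ))

/-- The displacement `σ z - z` has valuation at least `v z + d`. -/
def Gain (σ : Gal(L/K)) (d : ℤ) (z : L) : Prop :=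
  ∀ k : ℤ, (k : WithTop ℤ) ≤ v z → ((k + d : ℤ) : WithTop ℤ) ≤ v (σ z - z)

variable {v}

lemma Gain.mono {σ : Gal(L/K)} {d e : ℤ} {z : L} (h : Gain v σ d z) (hed : e ≤ d) :
    Gain v σ e z := fun k hk => le_val_of_le v (h k hk) (by omega)

lemma gain_of_fixed {σ : Gal(L/K)} (d : ℤ) {z : L} (h : σ z = z) : Gain v σ d z := by
  intro k _
  simp [h]

lemma gain_of_val_eq {σ : Gal(L/K)} {d k l : ℤ} {z : L} (hz : v z = (k : WithTop ℤ))
    (h : (l : WithTop ℤ) ≤ v (σ z - z)) (hl : k + d ≤ l) : Gain v σ d z := by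
  intro k' hk'
  rw [hz, WithTop.coe_le_coe] at hk'
  exact le_val_of_le v h (by omega)

lemma Gain.mul {σ : Gal(L/K)} (hσ : ∀ z, v (σ z) = v z) {d : ℤ} {y z : L}
    (hy : Gain v σ d y) (hz : Gain v σ d z) : Gain v σ d (y * z) := by
  intro k hk
  by_cases hy0 : y = 0
  · simp [hy0]
  by_cases hz0 : z = 0
  · simp [hz0]
  obtain ⟨a, ha⟩ := exists_val_eq v hy0
  obtain ⟨c, hc⟩ := exists_val_eq v hz0
  rw [val_mul_eq v ha hc, WithTop.coe_le_coe] at hk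
  have h1 := le_val_mul v ((hσ y).trans ha).ge (hz c hc.ge)
  have h2 := le_val_mul v (hy a ha.ge) hc.ge
  have h3 : σ (y * z) - y * z = σ y * (σ z - z) + (σ y - y) * z := by rw [map_mul]; ring
  rw [h3]
  exact v.map_le_add (le_val_of_le v h1 (by omega)) (le_val_of_le v h2 (by omega))

lemma Gain.pow {σ : Gal(L/K)} (hσ : ∀ z, v (σ z) = v z) {d : ℤ} {z : L}
    (hz : Gain v σ d z) (n : ℕ) : Gain v σ d (z ^ n) := by
  induction n with
  | zero => exact gain_of_fixed d (by simp)
  | succ n ih => rw [pow_succ]; exact ih.mul hσ hz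

lemma fixed_const (σ : Gal(L/K)) (c : F) : σ (algebraMap F L c) = algebraMap F L c := by
  rw [IsScalarTower.algebraMap_apply F K L]; exact σ.commutes _

/-- If every valuation that occurs in an intermediate field `E` is attained by an element of `E`
with a given gain, then all elements of `E` have this gain: subtract leading terms. -/
lemma gain_of_leading (hF : IsConstField v F) {σ : Gal(L/K)} (hσ : ∀ z, v (σ z) = v z) {d : ℤ}
    (E : IntermediateField K L)
    (h : ∀ (k : ℤ) (z : L), z ∈ E → v z = (k : WithTop ℤ) →
      ∃ g ∈ E, v g = (k : WithTop ℤ) ∧ Gain v σ d g) :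
    ∀ z ∈ E, Gain v σ d z := by
  intro z hz k hk
  refine induction_on_val v (fun z => z ∈ E ∧ (k : WithTop ℤ) ≤ v z)
    (fun z => ((k + d : ℤ) : WithTop ℤ) ≤ v (σ z - z)) (k + d) ?_ ?_ z ⟨hz, hk⟩
  · intro z _ hT
    exact v.map_le_sub (by rwa [hσ]) hT
  · rintro l z - ⟨hzE, hkz⟩ hl
    obtain ⟨g, hgE, hg, hgain⟩ := h l z hzE hl
    obtain ⟨c, hc⟩ := hF.exists_leading hl hg
    have hkl : k ≤ l := by rwa [hl, WithTop.coe_le_coe] at hkz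
    refine Or.inr ⟨z - algebraMap F L c * g, ⟨?_, le_val_of_le v hc (by omega)⟩, hc, ?_⟩
    · refine E.sub_mem hzE (E.mul_mem ?_ hgE)
      rw [IsScalarTower.algebraMap_apply F K L]
      exact E.algebraMap_mem _
    · intro h1
      have h2 := ((gain_of_fixed (v := v) d (fixed_const σ c)).mul hσ hgain) l
        (by simpa using le_val_mul v (hF.le_val_const c) hg.ge)
      have h3 : σ z - z = (σ (z - algebraMap F L c * g) - (z - algebraMap F L c * g)) +
          (σ (algebraMap F L c * g) - algebraMap F L c * g) := by rw [map_sub]; ring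
      rw [h3]
      exact v.map_le_add h1 (le_val_of_le v h2 (by omega))

end Gain

/-! ### Totally ramified extensions -/

section TotallyRamified

lemma val_sum_le_of_distinct {L ι : Type*} [Field L] (v : AddValuation L (WithTop ℤ))
    (s : Finset ι) (f : ι → L)
    (h : ∀ i ∈ s, ∀ j ∈ s, f i ≠ 0 → f j ≠ 0 → v (f i) = v (f j) → i = j) :
    ∀ i ∈ s, v (∑ j ∈ s, f j) ≤ v (f i) := by
  classical
  intro i hi
  obtain ⟨j, hj, hmin⟩ := s.exists_min_image (fun i => v (f i)) ⟨i, hi⟩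
  refine le_trans ?_ (hmin i hi)
  by_cases hj0 : f j = 0
  · simp [hj0]
  rw [← Finset.add_sum_erase _ _ hj, v.map_add_eq_of_lt_left]
  refine v.map_lt_sum' (lt_top_iff_ne_top.2 ((v.ne_top_iff).2 hj0)) fun l hl => ?_
  obtain ⟨hlj, hls⟩ := Finset.mem_erase.1 hl
  refine lt_of_le_of_ne (hmin l hls) fun he => hlj ?_
  have hl0 : f l ≠ 0 := by
    rw [← v.ne_top_iff, ← he, v.ne_top_iff]; exact hj0
  exact h l hls j hj hl0 hj0 he.symm

variable {F K L : Type*} [Field F] [Field K] [Field L] [Algebra F K] [Algebra K L]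
  {vK : AddValuation K (WithTop ℤ)} {vL : AddValuation L (WithTop ℤ)}

lemma IsTotallyRamified.val_algebraMap (hL : IsTotallyRamified vK vL) {z : K} {k : ℤ}
    (hz : vK z = (k : WithTop ℤ)) :
    vL (algebraMap K L z) = ((Module.finrank K L * k : ℤ) : WithTop ℤ) := by
  rw [hL.extends_base, hz, nsmul_coe]

lemma IsTotallyRamified.le_val_algebraMap (hL : IsTotallyRamified vK vL) {a : K} {k : ℤ}
    (h : (k : WithTop ℤ) ≤ vK a) :
    ((Module.finrank K L * k : ℤ) : WithTop ℤ) ≤ vL (algebraMap K L a) := by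
  rw [hL.extends_base, ← nsmul_coe]; exact nsmul_le_nsmul_right h _

lemma IsTotallyRamified.val_mul_pow (hL : IsTotallyRamified vK vL) {π : L}
    (hπ : vL π = ((1 : ℤ) : WithTop ℤ)) {a : K} {k : ℤ} (ha : vK a = (k : WithTop ℤ)) (i : ℕ) :
    vL (algebraMap K L a * π ^ i) = ((Module.finrank K L * k + i : ℤ) : WithTop ℤ) := by
  have := val_mul_eq vL (hL.val_algebraMap ha) (val_pow_eq vL hπ i)
  simpa using this

lemma IsTotallyRamified.distinct (hL : IsTotallyRamified vK vL) {π : L}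
    (hπ : vL π = ((1 : ℤ) : WithTop ℤ)) (a : Fin (Module.finrank K L) → K) :
    ∀ i, vL (∑ j, algebraMap K L (a j) * π ^ (j : ℕ)) ≤ vL (algebraMap K L (a i) * π ^ (i : ℕ)) := by
  intro i
  refine val_sum_le_of_distinct vL Finset.univ _ ?_ i (Finset.mem_univ i)
  intro i _ j _ hi hj hij
  have hi' : a i ≠ 0 := by rintro h; simp [h] at hi
  have hj' : a j ≠ 0 := by rintro h; simp [h] at hj
  obtain ⟨k, hk⟩ := exists_val_eq vK hi'
  obtain ⟨l, hl⟩ := exists_val_eq vK hj'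
  rw [hL.val_mul_pow hπ hk, hL.val_mul_pow hπ hl, WithTop.coe_inj] at hij
  have h1 := congrArg (· % (Module.finrank K L : ℤ)) hij
  simp only [Int.mul_add_emod_self_left] at h1
  rw [Int.emod_eq_of_lt (by positivity) (by exact_mod_cast i.2),
    Int.emod_eq_of_lt (by positivity) (by exact_mod_cast j.2)] at h1
  exact Fin.ext (by exact_mod_cast h1)

lemma IsTotallyRamified.le_val_coeff (hL : IsTotallyRamified vK vL) {π : L}
    (hπ : vL π = ((1 : ℤ) : WithTop ℤ)) {a : K} {k : ℤ} {i : ℕ} (hi : i < Module.finrank K L)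
    (h : ((Module.finrank K L * k : ℤ) : WithTop ℤ) ≤ vL (algebraMap K L a * π ^ i)) :
    (k : WithTop ℤ) ≤ vK a := by
  by_cases ha : a = 0
  · simp [ha]
  obtain ⟨l, hl⟩ := exists_val_eq vK ha
  rw [hL.val_mul_pow hπ hl, WithTop.coe_le_coe] at h
  rw [hl, WithTop.coe_le_coe]
  by_contra hkl
  have : (Module.finrank K L : ℤ) * l + i < Module.finrank K L * (l + 1) := by
    rw [mul_add]; have : (i : ℤ) < Module.finrank K L := by exact_mod_cast hi
    omega
  have h2 : (Module.finrank K L : ℤ) * (l + 1) ≤ Module.finrank K L * k :=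
    mul_le_mul_of_nonneg_left (by omega) (by positivity)
  omega

variable [FiniteDimensional K L]

/-- The powers of a uniformizer below the degree form a basis of a totally ramified extension, and
the valuation is the minimum of the valuations of the terms of an expansion. -/
lemma IsTotallyRamified.exists_expansion (hL : IsTotallyRamified vK vL) {π : L}
    (hπ : vL π = ((1 : ℤ) : WithTop ℤ)) (z : L) :
    ∃ a : Fin (Module.finrank K L) → K, z = ∑ j, algebraMap K L (a j) * π ^ (j : ℕ) ∧
      ∀ i, vL z ≤ vL (algebraMap K L (a i) * π ^ (i : ℕ)) := by
  have hli : LinearIndependent K (fun i : Fin (Module.finrank K L) => π ^ (i : ℕ)) := by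
    rw [Fintype.linearIndependent_iff]
    intro a ha i
    have h := hL.distinct hπ a i
    simp only [← Algebra.smul_def] at h
    rw [ha, vL.map_zero, top_le_iff, vL.top_iff, smul_eq_zero] at h
    exact h.resolve_right (pow_ne_zero _ (ne_zero_of_val_eq vL hπ))
  have hspan := hli.span_eq_top_of_card_eq_finrank' (by simp)
  have hz : z ∈ Submodule.span K (Set.range fun i : Fin (Module.finrank K L) => π ^ (i : ℕ)) := by
    rw [hspan]; trivial
  obtain ⟨a, rfl⟩ := (Submodule.mem_span_range_iff_exists_fun K).1 hz
  simp only [Algebra.smul_def]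
  exact ⟨a, rfl, hL.distinct hπ a⟩

/-- In the equation that expresses `π ^ N` by lower powers with integral coefficients, a conjugate
of `π` of negative valuation would make the left side strictly dominant. -/
lemma IsTotallyRamified.integral_uniformizer (hL : IsTotallyRamified vK vL) {π : L}
    (hπ : vL π = ((1 : ℤ) : WithTop ℤ)) (σ : Gal(L/K)) : ((0 : ℤ) : WithTop ℤ) ≤ vL (σ π) := by
  set N := Module.finrank K L with hN
  have hN0 : 0 < N := Module.finrank_pos
  have hπ0 : σ π ≠ 0 := by simpa using ne_zero_of_val_eq vL hπ
  obtain ⟨l, hl⟩ := exists_val_eq vL hπ0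
  rw [hl, WithTop.coe_le_coe]
  by_contra hneg
  obtain ⟨a, ha, hmin⟩ := hL.exists_expansion hπ (π ^ N)
  have hpow := val_pow_eq vL hl N
  rw [← map_pow, ha, map_sum] at hpow
  refine absurd hpow.le (not_le.2 ?_)
  rw [lt_iff_succ_le]
  refine vL.map_le_sum fun i _ => ?_
  rw [map_mul, map_pow, σ.commutes]
  have h1 : ((0 : ℤ) : WithTop ℤ) ≤ vK (a i) := by
    refine hL.le_val_coeff hπ i.2 (le_trans ?_ (hmin i))
    rw [val_pow_eq vL hπ, WithTop.coe_le_coe]; simp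
  have h2 := le_val_mul vL (hL.le_val_algebraMap h1) (val_pow_eq vL hl i).ge
  refine le_val_of_le vL h2 ?_
  have h3 : (i : ℤ) + 1 ≤ N := by exact_mod_cast i.2
  nlinarith

lemma IsTotallyRamified.integral_aut (hL : IsTotallyRamified vK vL) (σ : Gal(L/K)) {z : L}
    (hz : ((0 : ℤ) : WithTop ℤ) ≤ vL z) : ((0 : ℤ) : WithTop ℤ) ≤ vL (σ z) := by
  obtain ⟨π, hπ⟩ := hL.normalized 1
  obtain ⟨a, ha, hmin⟩ := hL.exists_expansion hπ z
  rw [ha, map_sum]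
  refine vL.map_le_sum fun i _ => ?_
  rw [map_mul, map_pow, σ.commutes]
  have h1 : ((0 : ℤ) : WithTop ℤ) ≤ vK (a i) :=
    hL.le_val_coeff hπ i.2 (le_trans (by simpa using hz) (hmin i))
  have h2 := le_val_mul vL (hL.le_val_algebraMap h1)
    (le_val_pow vL (hL.integral_uniformizer hπ σ) i)
  simpa using h2

lemma IsTotallyRamified.val_aut (hL : IsTotallyRamified vK vL) (hK : IsLocalField F vK)
    (σ : Gal(L/K)) (z : L) : vL (σ z) = vL z := by
  have key : ∀ (σ : Gal(L/K)) (z : L), vL z ≤ vL (σ z) := by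
    intro σ z
    by_cases hz0 : z = 0
    · simp [hz0]
    obtain ⟨k, hk⟩ := exists_val_eq vL hz0
    obtain ⟨a, ha⟩ := hK.normalized k
    have ha' := hL.val_algebraMap ha
    have hq : ((0 : ℤ) : WithTop ℤ) ≤ vL (z ^ Module.finrank K L / algebraMap K L a) := by
      rw [val_div_eq vL (val_pow_eq vL hk _) ha', sub_self]
    have h1 := le_val_mul vL (hL.integral_aut σ hq) ha'.ge
    rw [map_div₀, σ.commutes, div_mul_cancel₀ _ (ne_zero_of_val_eq vL ha'), map_pow, zero_add] at h1
    rw [hk]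
    exact le_val_of_pow vL Module.finrank_pos h1
  refine le_antisymm ?_ (key σ z)
  simpa using key σ⁻¹ (σ z)

lemma IsTotallyRamified.isConstField [Algebra F L] [IsScalarTower F K L]
    (hL : IsTotallyRamified vK vL) (hK : IsLocalField F vK) : IsConstField vL F where
  const_integral c := by
    rw [IsScalarTower.algebraMap_apply F K L]
    simpa using hL.le_val_algebraMap (k := 0) (hK.const_integral c)
  residue_surjective z hz := by
    obtain ⟨π, hπ⟩ := hL.normalized 1
    obtain ⟨a, ha, hmin⟩ := hL.exists_expansion hπ z
    have hint : ∀ i, ((0 : ℤ) : WithTop ℤ) ≤ vK (a i) := fun i =>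
      hL.le_val_coeff hπ i.2 (le_trans (by simpa using hz) (hmin i))
    have hN : 0 < Module.finrank K L := Module.finrank_pos
    obtain ⟨c, hc⟩ := hK.residue_surjective (a ⟨0, hN⟩) (hint _)
    refine ⟨c, ?_⟩
    rw [zero_lt_iff_one_le] at hc ⊢
    have hsum : z - algebraMap F L c = algebraMap K L (a ⟨0, hN⟩ - algebraMap F K c) +
        ∑ j ∈ Finset.univ.erase (⟨0, hN⟩ : Fin (Module.finrank K L)),
          algebraMap K L (a j) * π ^ (j : ℕ) := by
      rw [ha, ← Finset.add_sum_erase _ _ (Finset.mem_univ (⟨0, hN⟩ : Fin (Module.finrank K L))),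
        map_sub, ← IsScalarTower.algebraMap_apply F K L]
      simp only [pow_zero, mul_one]; ring
    rw [hsum]
    refine vL.map_le_add (le_val_of_le vL (hL.le_val_algebraMap hc) ?_) (vL.map_le_sum ?_)
    · have : (1 : ℤ) ≤ Module.finrank K L := by exact_mod_cast hN
      omega
    · intro j hj
      have hj0 : (j : ℕ) ≠ 0 := fun h => (Finset.mem_erase.1 hj).1 (Fin.ext h)
      have h2 := le_val_mul vL (hL.le_val_algebraMap (hint j)) (val_pow_eq vL hπ j).ge
      exact le_val_of_le vL h2 (by omega)

end TotallyRamified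

/-! ### Extensions with a single ramification break -/

section Break

variable {F K L : Type*} [Field F] [Field K] [Field L] [Algebra F K] [Algebra K L]
  [FiniteDimensional K L] {vK : AddValuation K (WithTop ℤ)} {vL : AddValuation L (WithTop ℤ)}

lemma mem_lowerRamificationGroup_break (hL : IsTotallyRamified vK vL) {b : ℕ}
    (hbreak : ramificationBreaks K vL = {(b : ℤ)}) (σ : Gal(L/K)) :
    σ ∈ lowerRamificationGroup K vL b := by
  have key : ∀ i : ℕ, i ≤ b + 1 → σ ∈ lowerRamificationGroup K vL ((i : ℤ) - 1) := by
    intro i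
    induction i with
    | zero =>
      intro _ x hx
      have hx' : ((0 : ℤ) : WithTop ℤ) ≤ vL x := hx
      simpa using vL.map_le_sub (hL.integral_aut σ hx') hx'
    | succ i ih =>
      intro hi
      have h1 := ih (by omega)
      have h2 : (i : ℤ) - 1 ∉ ramificationBreaks K vL := by
        rw [hbreak, Set.mem_singleton_iff]; omega
      have h3 : lowerRamificationGroup K vL ((i : ℤ) - 1) =
          lowerRamificationGroup K vL ((i : ℤ) - 1 + 1) := by
        by_contra hne
        exact h2 ⟨by omega, hne⟩
      rw [h3] at h1
      convert h1 using 2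
      push_cast; ring
  simpa using key (b + 1) le_rfl

lemma eq_one_of_mem_lowerRamificationGroup (hK : IsLocalField F vK)
    (hL : IsTotallyRamified vK vL) {b : ℕ}
    (hbreak : ramificationBreaks K vL = {(b : ℤ)}) {σ : Gal(L/K)}
    (hσ : σ ∈ lowerRamificationGroup K vL (b + 1)) : σ = 1 := by
  have key : ∀ i : ℕ, σ ∈ lowerRamificationGroup K vL (b + 1 + i) := by
    intro i
    induction i with
    | zero => simpa using hσ
    | succ i ih =>
      have h2 : (b : ℤ) + 1 + i ∉ ramificationBreaks K vL := by
        rw [hbreak, Set.mem_singleton_iff]; omega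
      have h3 : lowerRamificationGroup K vL ((b : ℤ) + 1 + i) =
          lowerRamificationGroup K vL ((b : ℤ) + 1 + i + 1) := by
        by_contra hne
        exact h2 ⟨by omega, hne⟩
      rw [h3] at ih
      convert ih using 2
      push_cast; ring
  have hint : ∀ x : L, ((0 : ℤ) : WithTop ℤ) ≤ vL x → σ x = x := by
    intro x hx
    by_contra hne
    obtain ⟨k, hk⟩ := exists_val_eq vL (sub_ne_zero.2 hne)
    have h := key k.toNat x hx
    rw [hk, WithTop.coe_le_coe] at h
    omega
  ext x
  by_cases hx0 : x = 0
  · simp [hx0]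
  obtain ⟨k, hk⟩ := exists_val_eq vL hx0
  obtain ⟨a, ha⟩ := hK.normalized (-k)
  rcases le_total 0 k with h | h
  · exact hint x (le_val_of_val_eq vL hk h)
  · have ha' := hL.val_algebraMap ha
    have h1 := hint (algebraMap K L a * x) (by
      refine le_val_of_val_eq vL (val_mul_eq vL ha' hk) ?_
      have : (1 : ℤ) ≤ Module.finrank K L := by exact_mod_cast Module.finrank_pos (R := K) (M := L)
      nlinarith)
    rw [map_mul, σ.commutes] at h1
    exact mul_left_cancel₀ (ne_zero_of_val_eq vL ha') h1

variable [Algebra F L] [IsScalarTower F K L]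

/-- If the valuation of `π` is prime to the ramification index, then powers of `π` times elements of
`K` have all valuations, and every element of `L` has the gain of `π`. -/
lemma gain_of_pow (hK : IsLocalField F vK) (hL : IsTotallyRamified vK vL) (σ : Gal(L/K)) {d : ℤ}
    {π : L} {e : ℤ} (hπ : vL π = (e : WithTop ℤ)) (he : IsCoprime e (Module.finrank K L : ℤ))
    (hgain : Gain vL σ d π) (z : L) : Gain vL σ d z := by
  refine gain_of_leading (hL.isConstField hK) (hL.val_aut hK σ) ⊤ ?_ z
    (IntermediateField.mem_top)
  intro k z _ hz
  set N : ℤ := (Module.finrank K L : ℤ) with hN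
  have hN0 : 0 < N := Int.natCast_pos.2 Module.finrank_pos
  obtain ⟨s, t, hst⟩ := he
  -- the exponent of `π` is the natural number in the class of `k / e` modulo `N`
  set i : ℕ := ((k * s) % N).toNat with hi
  have hi' : (i : ℤ) = k * s - N * (k * s / N) := by
    rw [hi, Int.toNat_of_nonneg (Int.emod_nonneg _ hN0.ne'), Int.emod_def]
  obtain ⟨a, ha⟩ := hK.normalized (k * t + e * (k * s / N))
  refine ⟨algebraMap K L a * π ^ i, IntermediateField.mem_top, ?_, ?_⟩
  · refine val_eq_congr vL (val_mul_eq vL (hL.val_algebraMap ha) (val_pow_eq vL hπ i)) ?_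
    rw [hi', ← hN]
    linear_combination k * hst
  · exact (gain_of_fixed d (σ.commutes a)).mul (hL.val_aut hK σ) (hgain.pow (hL.val_aut hK σ) i)

lemma gain_break (hK : IsLocalField F vK) (hL : IsTotallyRamified vK vL) {b : ℕ}
    (hbreak : ramificationBreaks K vL = {(b : ℤ)}) (σ : Gal(L/K)) (z : L) : Gain vL σ b z := by
  obtain ⟨π, hπ⟩ := hL.normalized 1
  refine gain_of_pow hK hL σ hπ isCoprime_one_left ?_ z
  refine gain_of_val_eq hπ (mem_lowerRamificationGroup_break hL hbreak σ π ?_) (by omega)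
  exact le_val_of_val_eq vL hπ (by norm_num)

/-- A larger displacement of a single element of valuation prime to the degree would be a gain of
`b + 1` on all of `L`, and put `σ` into the trivial ramification group `G_{b+1}`. -/
lemma val_sub_eq_break (hK : IsLocalField F vK) (hL : IsTotallyRamified vK vL) {b : ℕ}
    (hbreak : ramificationBreaks K vL = {(b : ℤ)}) {σ : Gal(L/K)} (hσ : σ ≠ 1) {z : L} {k : ℤ}
    (hz : vL z = (k : WithTop ℤ)) (hk : IsCoprime k (Module.finrank K L : ℤ)) :
    vL (σ z - z) = ((k + b : ℤ) : WithTop ℤ) := by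
  have h1 := gain_break hK hL hbreak σ z k hz.ge
  refine le_antisymm ?_ h1
  by_contra hlt
  rw [not_le, lt_iff_succ_le] at hlt
  have hg := gain_of_pow hK hL σ (d := b + 1) hz hk (gain_of_val_eq hz hlt (by omega))
  refine hσ (eq_one_of_mem_lowerRamificationGroup hK hL hbreak fun x hx => ?_)
  obtain ⟨c, hc⟩ := (hL.isConstField hK).residue_surjective x hx
  rw [zero_lt_iff_one_le] at hc
  have h2 := hg _ 1 hc
  have h3 : σ (x - algebraMap F L c) - (x - algebraMap F L c) = σ x - x := by
    rw [map_sub, fixed_const]; ring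
  rw [h3] at h2
  exact le_val_of_le vL h2 (by omega)

/-- If `p` divided the break, then `(σ - 1) ^ p = σ ^ p - 1 = 0` would raise the valuation of a
uniformizer by exactly `p * b`. -/
lemma not_dvd_break {p : ℕ} [Fact p.Prime] [CharP K p] (hK : IsLocalField F vK)
    (hL : IsTotallyRamified vK vL) {b : ℕ}
    (hbreak : ramificationBreaks K vL = {(b : ℤ)}) {n : ℕ} (hN : Module.finrank K L = p ^ n)
    {σ : Gal(L/K)} (hσ : σ ≠ 1) (hσp : σ ^ p = 1) : ¬ p ∣ b := by
  intro hpb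
  obtain ⟨π, hπ⟩ := hL.normalized 1
  set T : Module.End K L := AlgEquiv.toLinearMapHom K L σ with hT
  have key : ∀ i : ℕ, vL (((T - 1) ^ i) π) = ((1 + i * b : ℤ) : WithTop ℤ) := by
    intro i
    induction i with
    | zero => simpa using hπ
    | succ i ih =>
      rw [pow_succ', Module.End.mul_apply, LinearMap.sub_apply, Module.End.one_apply]
      refine val_eq_congr vL (val_sub_eq_break hK hL hbreak hσ ih ?_) (by push_cast; ring)
      rw [hN]
      push_cast
      refine IsCoprime.pow_right ?_
      obtain ⟨c, rfl⟩ := hpb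
      exact ⟨1, -(i * c), by push_cast; ring⟩
  have h0 : (T - 1) ^ p = 0 := by
    have : (Polynomial.X - 1 : Polynomial K) ^ p = Polynomial.X ^ p - 1 := by
      rw [sub_pow_char, one_pow]
    have h1 := congrArg (Polynomial.aeval T) this
    simp only [map_pow, map_sub, Polynomial.aeval_X, map_one] at h1
    rw [h1, hT, ← map_pow, hσp, map_one, sub_self]
  exact ne_zero_of_val_eq vL (key p) (by rw [h0]; simp)

end Break

/-! ### Towers of stages with one break -/

section Tower

variable {F K L : Type*} [Field F] [Field K] [Field L] [Algebra F K] [Algebra K L] [Algebra F L]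
  [IsScalarTower F K L] {n : ℕ}

/-- The subfield of `L` fixed by `σ i` for all `i ≥ e`. -/
def stage (σ : Fin n → Gal(L/K)) (e : ℕ) : IntermediateField K L :=
  IntermediateField.fixedField (Subgroup.closure {τ | ∃ i : Fin n, e ≤ (i : ℕ) ∧ σ i = τ})

lemma mem_stage {σ : Fin n → Gal(L/K)} {e : ℕ} {z : L} :
    z ∈ stage σ e ↔ ∀ i : Fin n, e ≤ (i : ℕ) → σ i z = z := by
  rw [stage, IntermediateField.mem_fixedField_iff]
  constructor
  · intro h i hi
    exact h _ (Subgroup.subset_closure ⟨i, hi, rfl⟩)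
  · intro h τ hτ
    induction hτ using Subgroup.closure_induction with
    | mem τ hτ => obtain ⟨i, hi, rfl⟩ := hτ; exact h i hi
    | one => rfl
    | mul τ τ' _ _ h1 h2 => rw [AlgEquiv.mul_apply, h2, h1]
    | inv τ _ h1 =>
      nth_rewrite 1 [← h1]
      exact τ.symm_apply_apply z

lemma stage_mono (σ : Fin n → Gal(L/K)) {e e' : ℕ} (h : e ≤ e') : stage σ e ≤ stage σ e' :=
  fun _ hz => mem_stage.2 fun i hi => mem_stage.1 hz i (h.trans hi)

/-- The automorphisms `σ i` span an elementary abelian `p`-group with fixed field `K`, and `v` is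
a Galois invariant valuation of `L` with ramification index `p ^ n` over `K`. -/
structure IsTower (p : ℕ) (v : AddValuation L (WithTop ℤ)) (σ : Fin n → Gal(L/K)) : Prop where
  val_aut : ∀ (τ : Gal(L/K)) (z : L), v (τ z) = v z
  comm : ∀ i j, σ i * σ j = σ j * σ i
  pow : ∀ i, σ i ^ p = 1
  bot : stage σ 0 = ⊥
  normalized : ∀ k : ℤ, ∃ z : L, v z = (k : WithTop ℤ)
  dvd_base : ∀ (z : K) (k : ℤ), v (algebraMap K L z) = (k : WithTop ℤ) → (p : ℤ) ^ n ∣ k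

/-- The norm along one step `stage σ i ⊆ stage σ (i + 1)` of the tower. -/
def stepNorm (p : ℕ) (σ : Fin n → Gal(L/K)) (i : Fin n) (z : L) : L :=
  ∏ j ∈ Finset.range p, (σ i ^ j) z

variable {p : ℕ} {v : AddValuation L (WithTop ℤ)} {σ : Fin n → Gal(L/K)}

lemma IsTower.stepNorm_mem (h : IsTower p v σ) {i : Fin n} {z : L}
    (hz : z ∈ stage σ (i + 1)) : stepNorm p σ i z ∈ stage σ i := by
  rw [mem_stage] at hz ⊢
  intro j hj
  rw [stepNorm, map_prod]
  rcases hj.eq_or_lt with hij | hij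
  · -- the generator of the step permutes the factors cyclically
    have hij' : j = i := Fin.ext hij.symm
    subst hij'
    have h1 : ∀ l, σ j ((σ j ^ l) z) = (σ j ^ (l + 1)) z := fun l => by
      rw [pow_succ', AlgEquiv.mul_apply]
    simp only [h1]
    have h2 := Finset.prod_range_succ' (fun l => (σ j ^ l) z) p
    have h3 := Finset.prod_range_succ (fun l => (σ j ^ l) z) p
    rw [h.pow] at h3
    by_cases hz0 : z = 0
    · simp [hz0]
    rw [h3] at h2
    have h4 : (1 : Gal(L/K)) z ≠ 0 := hz0
    exact (mul_right_cancel₀ h4 (by simpa using h2)).symm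
  · refine Finset.prod_congr rfl fun l _ => ?_
    have h1 : Commute (σ j) (σ i ^ l) := (show Commute (σ j) (σ i) from h.comm j i).pow_right l
    rw [← AlgEquiv.mul_apply, h1.eq, AlgEquiv.mul_apply, hz j hij]

lemma val_prod_eq (h : ∀ (τ : Gal(L/K)) (z : L), v (τ z) = v z) (τ : Gal(L/K)) {z : L} {k : ℤ}
    (hz : v z = (k : WithTop ℤ)) (q : ℕ) :
    v (∏ j ∈ Finset.range q, (τ ^ j) z) = ((q * k : ℤ) : WithTop ℤ) := by
  induction q with
  | zero => simp
  | succ q ih =>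
    rw [Finset.prod_range_succ]
    exact val_eq_congr v (val_mul_eq v ih ((h _ z).trans hz)) (by push_cast; ring)

lemma IsTower.val_stepNorm (h : IsTower p v σ) (i : Fin n) {z : L} {k : ℤ}
    (hz : v z = (k : WithTop ℤ)) : v (stepNorm p σ i z) = ((p * k : ℤ) : WithTop ℤ) :=
  val_prod_eq h.val_aut _ hz p

lemma IsTower.exists_mem_stage (h : IsTower p v σ) {e : ℕ} (he : e ≤ n) (k : ℤ) :
    ∃ z ∈ stage σ e, v z = (((p : ℤ) ^ (n - e) * k : ℤ) : WithTop ℤ) := by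
  induction he using Nat.decreasingInduction with
  | self =>
    obtain ⟨z, hz⟩ := h.normalized k
    exact ⟨z, mem_stage.2 fun i hi => absurd i.2 (by omega), by simpa using hz⟩
  | of_succ e he ih =>
    obtain ⟨z, hz, hk⟩ := ih
    refine ⟨stepNorm p σ ⟨e, he⟩ z, h.stepNorm_mem (i := ⟨e, he⟩) hz, ?_⟩
    refine val_eq_congr v (h.val_stepNorm _ hk) ?_
    rw [show n - e = n - (e + 1) + 1 by omega, pow_succ]; ring

lemma IsTower.dvd_of_mem_stage (h : IsTower p v σ) (hp : 0 < p) {e : ℕ} (he : e ≤ n) {z : L}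
    (hz : z ∈ stage σ e) {k : ℤ} (hk : v z = (k : WithTop ℤ)) : (p : ℤ) ^ (n - e) ∣ k := by
  induction e generalizing z k with
  | zero =>
    rw [h.bot, IntermediateField.mem_bot] at hz
    obtain ⟨a, rfl⟩ := hz
    exact h.dvd_base a k hk
  | succ e ih =>
    have h1 := ih (by omega) (h.stepNorm_mem (i := ⟨e, he⟩) hz) (h.val_stepNorm _ hk)
    rw [show n - e = n - (e + 1) + 1 by omega, pow_succ, mul_comm] at h1
    exact Int.dvd_of_mul_dvd_mul_left (by omega) h1

/-- On the stage `e` all automorphisms have the gain `p ^ (n - e) * b`: with respect to its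
normalized valuation the stage still has the single break `b` over `K`. -/
def StageGain (p b : ℕ) (v : AddValuation L (WithTop ℤ)) (σ : Fin n → Gal(L/K)) (e : ℕ) : Prop :=
  ∀ τ : Gal(L/K), ∀ z ∈ stage σ e, Gain v τ ((p : ℤ) ^ (n - e) * b) z

lemma IsTower.stageGain_zero (h : IsTower p v σ) (b : ℕ) : StageGain p b v σ 0 := by
  intro τ z hz
  rw [h.bot, IntermediateField.mem_bot] at hz
  obtain ⟨a, rfl⟩ := hz
  exact gain_of_fixed _ (τ.commutes a)

/-- Powers of an element of valuation `-b` in the normalization of its stage represent, up to the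
previous stage, all valuations. -/
lemma IsTower.stageGain_succ [Fact p.Prime] (h : IsTower p v σ) (hF : IsConstField v F) {b e : ℕ}
    (hb : ¬ p ∣ b) (he : e < n) (hS : StageGain p b v σ e) {Y : L} (hY : Y ∈ stage σ (e + 1))
    (hvY : v Y = ((-((p : ℤ) ^ (n - (e + 1)) * b) : ℤ) : WithTop ℤ))
    (hτY : ∀ τ : Gal(L/K), ((0 : ℤ) : WithTop ℤ) ≤ v (τ Y - Y)) : StageGain p b v σ (e + 1) := by
  intro τ
  have hp : p.Prime := Fact.out
  refine gain_of_leading hF (h.val_aut τ) _ fun k z hz hk => ?_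
  obtain ⟨k, rfl⟩ := h.dvd_of_mem_stage hp.pos he hz hk
  have hcop : IsCoprime (b : ℤ) (p : ℤ) :=
    Nat.isCoprime_iff_coprime.2 ((Nat.Prime.coprime_iff_not_dvd hp).2 hb).symm
  obtain ⟨s, t, hst⟩ := hcop
  -- the exponent is the natural number in the class of `-k / b` modulo `p`
  set i : ℕ := ((-(k * s)) % (p : ℤ)).toNat with hi
  have hp0 : (p : ℤ) ≠ 0 := by exact_mod_cast hp.ne_zero
  have hi' : (i : ℤ) = -(k * s) - p * (-(k * s) / p) := by
    rw [hi, Int.toNat_of_nonneg (Int.emod_nonneg _ hp0), Int.emod_def]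
  obtain ⟨a, ha, hva⟩ := h.exists_mem_stage (e := e) (by omega) (k * t - b * (-(k * s) / p))
  have hpow : (p : ℤ) ^ (n - e) = (p : ℤ) ^ (n - (e + 1)) * p := by
    rw [show n - e = n - (e + 1) + 1 by omega, pow_succ]
  refine ⟨a * Y ^ i, mul_mem (stage_mono σ (Nat.le_succ e) ha) (pow_mem hY i), ?_, ?_⟩
  · refine val_eq_congr v (val_mul_eq v hva (val_pow_eq v hvY i)) ?_
    rw [hi', hpow]
    linear_combination (p : ℤ) ^ (n - (e + 1)) * k * hst
  · refine ((hS τ a ha).mono ?_).mul (h.val_aut τ) (Gain.pow (h.val_aut τ) ?_ i)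
    · rw [hpow, mul_assoc]
      refine mul_le_mul_of_nonneg_left ?_ (by positivity)
      have : (1 : ℤ) ≤ p := by exact_mod_cast hp.pos
      nlinarith
    · exact gain_of_val_eq hvY (hτY τ) (by omega)

lemma IsTower.le_val_prod_sub_pow (h : IsTower p v σ) {τ : Gal(L/K)} {z : L} {k d : ℤ}
    (hz : (k : WithTop ℤ) ≤ v z)
    (hd : ∀ j : ℕ, ((k + d : ℤ) : WithTop ℤ) ≤ v ((τ ^ j) z - z)) (q : ℕ) :
    ((q * k + d : ℤ) : WithTop ℤ) ≤ v (∏ j ∈ Finset.range q, (τ ^ j) z - z ^ q) := by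
  induction q with
  | zero => simp
  | succ q ih =>
    rw [Finset.prod_range_succ]
    have h1 : (∏ j ∈ Finset.range q, (τ ^ j) z) * (τ ^ q) z - z ^ (q + 1) =
        (∏ j ∈ Finset.range q, (τ ^ j) z - z ^ q) * (τ ^ q) z + z ^ q * ((τ ^ q) z - z) := by ring
    rw [h1]
    have h2 : (k : WithTop ℤ) ≤ v ((τ ^ q) z) := by rwa [h.val_aut]
    refine v.map_le_add (le_val_of_le v (le_val_mul v ih h2) ?_)
      (le_val_of_le v (le_val_mul v (le_val_pow v hz q) (hd q)) ?_) <;> push_cast <;> linarith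

/-- Approximate `p`-th roots, one stage further up. An element of the stage `e` of not too negative
valuation is, up to integral elements, a combination of norms from the stage `e + 1`, and such a
norm agrees with a `p`-th power up to integral elements. -/
lemma IsTower.exists_root_succ [Fact p.Prime] [CharP L p] (h : IsTower p v σ)
    (hF : IsConstField v F) (hperf : ∀ c : F, ∃ d : F, d ^ p = c) {b e : ℕ} (he : e < n)
    (hS : StageGain p b v σ (e + 1)) {z : L} (hz : z ∈ stage σ e)
    (hvz : ((-((p : ℤ) ^ (n - (e + 1)) * b) : ℤ) : WithTop ℤ) ≤ v z) :
    ∃ κ ∈ stage σ (e + 1), ((0 : ℤ) : WithTop ℤ) ≤ v (κ ^ p - z) := by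
  have hp : p.Prime := Fact.out
  refine induction_on_val v
    (fun z => z ∈ stage σ e ∧ ((-((p : ℤ) ^ (n - (e + 1)) * b) : ℤ) : WithTop ℤ) ≤ v z)
    (fun z => ∃ κ ∈ stage σ (e + 1), ((0 : ℤ) : WithTop ℤ) ≤ v (κ ^ p - z)) 0 ?_ ?_ z ⟨hz, hvz⟩
  · intro z _ h0
    exact ⟨0, zero_mem _, by rw [zero_pow hp.ne_zero, zero_sub, v.map_neg]; exact h0⟩
  · rintro k z - ⟨hz, hvz⟩ hk
    obtain ⟨k, rfl⟩ := h.dvd_of_mem_stage hp.pos he.le hz hk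
    have hpow : (p : ℤ) ^ (n - e) = p * (p : ℤ) ^ (n - (e + 1)) := by
      rw [show n - e = n - (e + 1) + 1 by omega, pow_succ']
    obtain ⟨κ₀, hκ₀, hv₀⟩ := h.exists_mem_stage (e := e + 1) he k
    set N := stepNorm p σ ⟨e, he⟩ κ₀ with hN
    have hNmem : N ∈ stage σ e := h.stepNorm_mem (i := ⟨e, he⟩) hκ₀
    have hvN : v N = (((p : ℤ) ^ (n - e) * k : ℤ) : WithTop ℤ) :=
      val_eq_congr v (h.val_stepNorm _ hv₀) (by rw [hpow]; ring)
    obtain ⟨c, hc⟩ := hF.exists_leading hk hvN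
    obtain ⟨d, rfl⟩ := hperf c
    rw [hk, WithTop.coe_le_coe] at hvz
    have hFmem : ∀ (c : F) (e : ℕ), algebraMap F L c ∈ stage σ e := fun c e => by
      rw [IsScalarTower.algebraMap_apply F K L]; exact IntermediateField.algebraMap_mem _ _
    refine Or.inr ⟨z - algebraMap F L (d ^ p) * N, ⟨sub_mem hz (mul_mem (hFmem _ _) hNmem),
      le_val_of_le v hc (by omega)⟩, hc, ?_⟩
    rintro ⟨κ, hκ, hvκ⟩
    refine ⟨κ + algebraMap F L d * κ₀, add_mem hκ (mul_mem (hFmem _ _) hκ₀), ?_⟩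
    have h1 : (κ + algebraMap F L d * κ₀) ^ p - z =
        (κ ^ p - (z - algebraMap F L (d ^ p) * N)) - algebraMap F L (d ^ p) * (N - κ₀ ^ p) := by
      rw [add_pow_char, mul_pow, map_pow]; ring
    rw [h1]
    refine v.map_le_sub hvκ ?_
    have h2 := h.le_val_prod_sub_pow (τ := σ ⟨e, he⟩) hv₀.ge
      (fun j => hS (σ ⟨e, he⟩ ^ j) κ₀ hκ₀ _ hv₀.ge) p
    refine le_val_of_le v (le_val_mul v (hF.le_val_const _) h2) ?_
    rw [hpow] at hvz
    linarith

/-- Approximate `p ^ e`-th roots of elements of `K` in the stage `e`. -/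
lemma IsTower.exists_root [Fact p.Prime] [CharP L p] (h : IsTower p v σ)
    (hF : IsConstField v F) (hperf : ∀ c : F, ∃ d : F, d ^ p = c) {b e : ℕ} (he : e < n)
    (hS : ∀ e' ≤ e, StageGain p b v σ e') {z : K}
    (hvz : ((-((p : ℤ) ^ (n - 1) * b) : ℤ) : WithTop ℤ) ≤ v (algebraMap K L z)) :
    ∃ κ ∈ stage σ e, ((0 : ℤ) : WithTop ℤ) ≤ v (κ ^ p ^ e - algebraMap K L z) ∧
      ((-((p : ℤ) ^ (n - (e + 1)) * b) : ℤ) : WithTop ℤ) ≤ v κ := by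
  have hp : p.Prime := Fact.out
  induction e with
  | zero =>
    refine ⟨algebraMap K L z, IntermediateField.algebraMap_mem _ _, by simp, by simpa using hvz⟩
  | succ e ih =>
    obtain ⟨κ, hκ, h1, h2⟩ := ih (by omega) fun e' he' => hS e' (by omega)
    obtain ⟨κ', hκ', h3⟩ := h.exists_root_succ hF hperf (by omega) (hS _ le_rfl) hκ h2
    refine ⟨κ', hκ', ?_, ?_⟩
    · have h4 : κ' ^ p ^ (e + 1) - algebraMap K L z =
          (κ' ^ p - κ) ^ p ^ e + (κ ^ p ^ e - algebraMap K L z) := by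
        rw [sub_pow_char_pow, ← pow_mul, ← pow_succ']; ring
      rw [h4]
      exact v.map_le_add (by simpa using le_val_pow v h3 (p ^ e)) h1
    · have h5 := v.map_le_add (le_val_of_le v h3
        (neg_nonpos.2 (by positivity) : (-((p : ℤ) ^ (n - (e + 1)) * b) : ℤ) ≤ 0)) h2
      rw [sub_add_cancel] at h5
      refine le_val_of_pow v hp.pos (le_val_of_le v h5 (le_of_eq ?_))
      rw [show n - (e + 1) = n - (e + 1 + 1) + 1 by omega, pow_succ]; ring

/-- On the last step, the break alone forces the existence of a generator of valuation `-b`: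
subtract leading terms from the lower field as long as the valuation is divisible by `p`. -/
lemma IsTower.exists_generator_last {b : ℕ} (h : IsTower p v σ) (hF : IsConstField v F) {j : Fin n}
    (hj : (j : ℕ) + 1 = n) (hgain : ∀ z, Gain v (σ j) b z)
    (hexact : ∀ (z : L) (k : ℤ), v z = (k : WithTop ℤ) → ¬ (p : ℤ) ∣ k →
      v (σ j z - z) = ((k + b : ℤ) : WithTop ℤ)) {z : L} (hz : σ j z = z + 1) :
    ∃ κ ∈ stage σ j, v (z - κ) = ((-b : ℤ) : WithTop ℤ) := by
  refine induction_on_val v (fun z => σ j z = z + 1)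
    (fun z => ∃ κ ∈ stage σ j, v (z - κ) = ((-b : ℤ) : WithTop ℤ)) (1 - b) ?_ ?_ z hz
  · intro z hz hT
    have h1 := hgain z _ hT
    rw [hz, add_sub_cancel_left, v.map_one] at h1
    have h2 : (1 - (b : ℤ) + b) ≤ 0 := by exact_mod_cast h1
    omega
  · intro k z _ hz hk
    by_cases hpk : (p : ℤ) ∣ k
    · obtain ⟨k, rfl⟩ := hpk
      obtain ⟨g, hg, hvg⟩ := h.exists_mem_stage (e := j) (by omega) k
      rw [show n - (j : ℕ) = 1 by omega, pow_one] at hvg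
      obtain ⟨c, hc⟩ := hF.exists_leading hk hvg
      have hcg : algebraMap F L c * g ∈ stage σ j := by
        refine mul_mem ?_ hg
        rw [IsScalarTower.algebraMap_apply F K L]; exact IntermediateField.algebraMap_mem _ _
      refine Or.inr ⟨z - algebraMap F L c * g, ?_, hc, ?_⟩
      · rw [map_sub, hz, mem_stage.1 hcg j le_rfl]; ring
      · rintro ⟨κ, hκ, hv⟩
        exact ⟨algebraMap F L c * g + κ, add_mem hcg hκ, by rwa [← sub_sub]⟩
    · left
      have h1 := hexact z k hk hpk
      rw [hz, add_sub_cancel_left, v.map_one] at h1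
      have h2 : 0 = k + b := by exact_mod_cast h1
      exact ⟨0, zero_mem _, by rw [sub_zero, hk]; congr 1; omega⟩

end Tower

/-! ### Moore determinants -/

section Moore

variable {F : Type*} [Field F] {p : ℕ} [Fact p.Prime] [Algebra (ZMod p) F]

lemma zmod_smul_pow (t : ZMod p) (x : F) (k : ℕ) : (t • x) ^ p ^ k = t • x ^ p ^ k := by
  rw [Algebra.smul_def, Algebra.smul_def, mul_pow, ← map_pow, ZMod.pow_card_pow]

variable [CharP F p]

lemma linearIndependent_pow {ι : Type*} [Fintype ι] {ω : ι → F}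
    (h : LinearIndependent (ZMod p) ω) (k : ℕ) :
    LinearIndependent (ZMod p) (fun i => ω i ^ p ^ k) := by
  rw [Fintype.linearIndependent_iff] at h ⊢
  intro t ht
  refine h t (pow_eq_zero_iff (pow_ne_zero k (Fact.out : p.Prime).ne_zero) |>.1 ?_)
  rw [sum_pow_char_pow, ← ht]
  exact Finset.sum_congr rfl fun i _ => zmod_smul_pow _ _ _

/-- A nonzero additive polynomial of degree less than `p ^ j` cannot vanish on the `𝔽_p`-span of
`j` independent elements, which has `p ^ j` elements. -/
lemma moore_injective {j : ℕ} {ω : Fin j → F} (h : LinearIndependent (ZMod p) ω) {a : Fin j → F}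
    (ha : ∀ i, ∑ s : Fin j, a s * ω i ^ p ^ (s : ℕ) = 0) : a = 0 := by
  have hp : p.Prime := Fact.out
  set P : Polynomial F := ∑ s : Fin j, Polynomial.C (a s) * Polynomial.X ^ p ^ (s : ℕ) with hP
  have hP0 : P = 0 := by
    rcases Nat.eq_zero_or_pos j with rfl | hj
    · simp [hP]
    refine Polynomial.eq_zero_of_natDegree_lt_card_of_eval_eq_zero P
      (f := fun t : Fin j → ZMod p => ∑ i, t i • ω i) ?_ ?_ ?_
    · intro t u htu
      refine funext fun i => sub_eq_zero.1
        (Fintype.linearIndependent_iff.1 h (fun i => t i - u i) ?_ i)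
      simp only [sub_smul, Finset.sum_sub_distrib]
      exact sub_eq_zero.2 htu
    · intro t
      rw [hP, Polynomial.eval_finsetSum]
      simp only [Polynomial.eval_mul, Polynomial.eval_C, Polynomial.eval_pow, Polynomial.eval_X,
        sum_pow_char_pow, zmod_smul_pow, Finset.mul_sum]
      rw [Finset.sum_comm]
      refine Finset.sum_eq_zero fun i _ => ?_
      simp only [mul_smul_comm]
      rw [← Finset.smul_sum, ha, smul_zero]
    · have h1 : P.natDegree ≤ p ^ (j - 1) := by
        refine Polynomial.natDegree_sum_le_of_forall_le _ _ fun s _ => ?_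
        refine (Polynomial.natDegree_C_mul_X_pow_le _ _).trans ?_
        exact Nat.pow_le_pow_right hp.pos (by omega)
      refine h1.trans_lt ?_
      simp only [Fintype.card_fun, ZMod.card, Fintype.card_fin]
      exact Nat.pow_lt_pow_right hp.one_lt (by omega)
  ext s
  have h2 := congrArg (fun Q => Q.coeff (p ^ (s : ℕ))) hP0
  simp only [hP, Polynomial.finsetSum_coeff, Polynomial.coeff_C_mul, Polynomial.coeff_X_pow,
    Polynomial.coeff_zero, (Nat.pow_right_injective hp.two_le).eq_iff, Fin.val_inj, mul_ite,
    mul_one, mul_zero, Finset.sum_ite_eq, Finset.mem_univ, if_true] at h2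
  exact h2

lemma moore_det_ne_zero {j : ℕ} {ω : Fin j → F} (h : LinearIndependent (ZMod p) ω) :
    (Matrix.of fun i s : Fin j => ω i ^ p ^ (s : ℕ)).det ≠ 0 := by
  intro h0
  obtain ⟨a, ha0, ha⟩ := Matrix.exists_mulVec_eq_zero_iff.2 h0
  refine ha0 (moore_injective h fun i => ?_)
  have := congrFun ha i
  simp only [Matrix.mulVec, dotProduct, Matrix.of_apply, Pi.zero_apply] at this
  rw [← this]
  exact Finset.sum_congr rfl fun s _ => mul_comm _ _

/-- Coefficients that are dual to the Frobenius powers: the combination of the `ω i ^ p ^ s`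
vanishes for all `s ≤ j` except for `s = 0`. -/
lemma exists_moore_dual {j : ℕ} {ω : Fin (j + 1) → F} (h : LinearIndependent (ZMod p) ω) :
    ∃ c : Fin (j + 1) → F, c (Fin.last j) = 1 ∧ ∑ i, c i * ω i ≠ 0 ∧
      ∀ s : ℕ, 1 ≤ s → s ≤ j → ∑ i, c i * ω i ^ p ^ s = 0 := by
  set M := Matrix.of fun i s : Fin (j + 1) => ω i ^ p ^ (s : ℕ) with hM
  have hdet : IsUnit M.det := isUnit_iff_ne_zero.2 (moore_det_ne_zero h)
  set c : Fin (j + 1) → F := Matrix.vecMul (Pi.single 0 1) M⁻¹ with hc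
  have hcM : Matrix.vecMul c M = Pi.single 0 1 := by
    rw [hc, Matrix.vecMul_vecMul, Matrix.nonsing_inv_mul _ hdet, Matrix.vecMul_one]
  have hval : ∀ s : Fin (j + 1), ∑ i, c i * ω i ^ p ^ (s : ℕ) = if s = 0 then 1 else 0 := by
    intro s
    have := congrFun hcM s
    simpa [Matrix.vecMul, dotProduct, hM, Pi.single_apply] using this
  have hzero : ∀ s : ℕ, 1 ≤ s → s ≤ j → ∑ i, c i * ω i ^ p ^ s = 0 := by
    intro s hs hsj
    have := hval ⟨s, by omega⟩
    rwa [if_neg (by rw [Fin.ext_iff]; simp; omega)] at this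
  have hone : ∑ i, c i * ω i = 1 := by simpa using hval 0
  have hlast : c (Fin.last j) ≠ 0 := by
    -- otherwise the remaining coefficients are killed by the smaller Moore matrix of `ω ^ p`
    intro h0
    have hli : LinearIndependent (ZMod p) fun i : Fin j => ω i.castSucc ^ p ^ 1 :=
      linearIndependent_pow (h.comp _ (Fin.castSucc_injective j)) 1
    have hc' : (fun i : Fin j => c i.castSucc) = 0 := by
      by_contra hne
      refine moore_det_ne_zero hli (Matrix.exists_vecMul_eq_zero_iff.1 ⟨_, hne, ?_⟩)
      ext s
      have := hzero (s + 1) (by omega) s.2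
      rw [Fin.sum_univ_castSucc, h0, zero_mul, add_zero] at this
      simp only [Matrix.vecMul, dotProduct, Matrix.of_apply, Pi.zero_apply]
      rw [← this]
      refine Finset.sum_congr rfl fun i _ => ?_
      rw [← pow_mul, ← pow_add, add_comm]
    rw [Fin.sum_univ_castSucc, h0, zero_mul, add_zero] at hone
    refine zero_ne_one (hone.symm.trans (Finset.sum_eq_zero fun i _ => ?_)).symm
    rw [show c i.castSucc = 0 from congrFun hc' i, zero_mul]
  refine ⟨fun i => (c (Fin.last j))⁻¹ * c i, inv_mul_cancel₀ hlast, ?_, fun s hs hsj => ?_⟩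
  · simp only [mul_assoc]
    rw [← Finset.mul_sum, hone, mul_one]
    exact inv_ne_zero hlast
  · simp only [mul_assoc]
    rw [← Finset.mul_sum, hzero s hs hsj, mul_zero]

lemma sum_castLE {n j : ℕ} (hj : j ≤ n) {A : Type*} [AddCommMonoid A] (f : Fin n → A)
    (hf : ∀ i : Fin n, j ≤ (i : ℕ) → f i = 0) :
    ∑ i, f i = ∑ i : Fin j, f (Fin.castLE hj i) := by
  rw [show ∑ i : Fin j, f (Fin.castLE hj i) = ∑ i ∈ Finset.univ.map (Fin.castLEEmb hj), f i from
    (Finset.sum_map Finset.univ (Fin.castLEEmb hj) f).symm]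
  refine (Finset.sum_subset (Finset.subset_univ _) fun i _ hi => hf i ?_).symm
  by_contra hlt
  exact hi (Finset.mem_map.2 ⟨⟨i, by omega⟩, Finset.mem_univ _, rfl⟩)

/-- Unitriangular coefficients for which the combination of the Frobenius twists of `ω` by
`p ^ (n - 1), …, p ^ (n - j)` vanishes, while that by `p ^ (n - (j + 1))` does not. -/
lemma exists_coeffs {n : ℕ} {ω : Fin n → F} (h : LinearIndependent (ZMod p) ω) (j : Fin n) :
    ∃ c : Fin n → F, c j = 1 ∧ (∀ i, j < i → c i = 0) ∧
      ∑ i, c i * ω i ^ p ^ (n - (j + 1)) ≠ 0 ∧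
      ∀ s : ℕ, 1 ≤ s → s ≤ j → ∑ i, c i * ω i ^ p ^ (n - s) = 0 := by
  have hj : (j : ℕ) + 1 ≤ n := j.2
  obtain ⟨c, hc1, hc2, hc3⟩ := exists_moore_dual (linearIndependent_pow
    (h.comp (Fin.castLE hj) (Fin.castLE_injective hj)) (n - (j + 1)))
  set c' : Fin n → F := fun i => if hi : (i : ℕ) < j + 1 then c ⟨i, hi⟩ else 0 with hc'
  have hsum : ∀ g : Fin n → F, ∑ i, c' i * g i =
      ∑ i : Fin (j + 1), c i * g (Fin.castLE hj i) := by
    intro g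
    rw [sum_castLE hj]
    · refine Finset.sum_congr rfl fun i _ => ?_
      exact congrArg (· * g (Fin.castLE hj i)) (dif_pos i.2)
    · intro i hi
      rw [show c' i = 0 from dif_neg (by omega), zero_mul]
  refine ⟨c', ?_, ?_, ?_, ?_⟩
  · rw [← hc1, hc']
    simp only [Nat.lt_succ_self, dif_pos]
    rfl
  · intro i hi
    have : (j : ℕ) < i := hi
    exact dif_neg (by omega)
  · rw [hsum]
    exact hc2
  · intro s hs hsj
    rw [hsum, ← hc3 (j + 1 - s) (by omega) (by omega)]
    refine Finset.sum_congr rfl fun i _ => ?_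
    rw [← pow_mul, ← pow_add]
    congr 3
    omega

end Moore

/-! ### Artin–Schreier generators of prescribed valuation -/

section Generators

variable {F K L : Type*} [Field F] [Field K] [Field L] [Algebra F K] [Algebra K L] [Algebra F L]
  [IsScalarTower F K L] {n : ℕ} {p : ℕ} [Fact p.Prime]
  {v : AddValuation L (WithTop ℤ)} {σ : Fin n → Gal(L/K)}

lemma iterate_artinSchreier [CharP L p] {x A : L} (h : x ^ p - x = A) (k : ℕ) :
    x ^ p ^ k = x + ∑ s ∈ Finset.range k, A ^ p ^ s := by
  induction k with
  | zero => simp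
  | succ k ih =>
    rw [pow_succ', pow_mul, ← sub_add_cancel (x ^ p) x, h, add_pow_char_pow, ih,
      Finset.sum_range_succ]
    ring

/-- The `p ^ J`-th power of a combination of Artin–Schreier generators whose coefficients are dual
to the Frobenius twists of `ω`: only one multiple of `β` survives. -/
lemma combination_pow [CharP F p] [CharP L p] {J : ℕ} (hJ : J ≤ n) {β : L} {ω c : Fin n → F}
    {ε x : Fin n → L}
    (hx : ∀ i, x i ^ p - x i = algebraMap F L (ω i) ^ p ^ n * β + ε i)
    (hc : ∀ s : ℕ, 1 ≤ s → s < J → ∑ i, c i * ω i ^ p ^ (n - s) = 0) (hJ0 : 0 < J) :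
    (∑ i, algebraMap F L (c i) * x i) ^ p ^ J =
      algebraMap F L ((∑ i, c i * ω i ^ p ^ (n - J)) ^ p ^ J) * β +
      (∑ i, algebraMap F L (c i) ^ p ^ J * x i + ∑ s ∈ Finset.range J,
        (∑ i, algebraMap F L (c i) ^ p ^ (J - s) * ε i) ^ p ^ s) := by
  have h1 : ∀ i, x i ^ p ^ J = x i + ∑ s ∈ Finset.range J,
      (algebraMap F L (ω i) ^ p ^ (n + s) * β ^ p ^ s + ε i ^ p ^ s) := by
    intro i
    rw [iterate_artinSchreier (hx i)]
    congr 1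
    refine Finset.sum_congr rfl fun s _ => ?_
    rw [add_pow_char_pow, mul_pow, ← pow_mul, ← pow_add]
  have h2 : ∀ s ∈ Finset.range J,
      (∑ i, algebraMap F L (c i) ^ p ^ (J - s) * ε i) ^ p ^ s =
        ∑ i, algebraMap F L (c i) ^ p ^ J * ε i ^ p ^ s := by
    intro s hs
    rw [sum_pow_char_pow]
    refine Finset.sum_congr rfl fun i _ => ?_
    rw [mul_pow, ← pow_mul, ← pow_add, Nat.sub_add_cancel (Finset.mem_range.1 hs).le]
  have h3 : ∀ s ∈ Finset.range J,
      ∑ i, algebraMap F L (c i) ^ p ^ J * (algebraMap F L (ω i) ^ p ^ (n + s) * β ^ p ^ s) =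
        algebraMap F L ((∑ i, c i * ω i ^ p ^ (n - (J - s))) ^ p ^ J) * β ^ p ^ s := by
    intro s hs
    have hs' := Finset.mem_range.1 hs
    rw [sum_pow_char_pow, map_sum, Finset.sum_mul]
    refine Finset.sum_congr rfl fun i _ => ?_
    rw [mul_pow, ← pow_mul (ω i), ← pow_add, map_mul, map_pow, map_pow,
      show n - (J - s) + J = n + s by omega]
    ring
  rw [sum_pow_char_pow]
  simp only [mul_pow, h1, mul_add, Finset.mul_sum, Finset.sum_add_distrib]
  rw [Finset.sum_comm, Finset.sum_congr rfl h3, Finset.sum_congr rfl h2,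
    Finset.sum_comm (s := Finset.univ) (t := Finset.range J),
    Finset.sum_eq_single_of_mem 0 (Finset.mem_range.2 hJ0)]
  · simp only [Nat.sub_zero, pow_zero, pow_one]; ring
  · intro s hs hs0
    rw [hc (J - s) (by have := Finset.mem_range.1 hs; omega) (by omega),
      zero_pow (pow_ne_zero _ (Fact.out : p.Prime).ne_zero), map_zero, zero_mul]

lemma le_val_pow_of_le {x : L} {q a a' : ℕ} (hq : 0 < q) (ha : a ≤ a') {k : ℤ} (hk : k ≤ 0)
    (h : (k : WithTop ℤ) ≤ v (x ^ q ^ a')) : (k : WithTop ℤ) ≤ v (x ^ q ^ a) := by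
  by_cases hx : x = 0
  · simp [hx, hq.ne']
  obtain ⟨e, he⟩ := exists_val_eq v hx
  rw [val_pow_eq v he, WithTop.coe_le_coe] at h ⊢
  have h1 : ((q ^ a : ℕ) : ℤ) ≤ ((q ^ a' : ℕ) : ℤ) := by
    exact_mod_cast Nat.pow_le_pow_right hq ha
  rcases le_total 0 e with he0 | he0
  · exact hk.trans (mul_nonneg (by positivity) he0)
  · exact h.trans (mul_le_mul_of_nonpos_right h1 he0)

/-- A root of `X ^ p - X - A` has a pole of strictly smaller order than the bound on that of `A`. -/
lemma le_val_of_artinSchreier {x A : L} (h : x ^ p - x = A) {k : ℤ} (hk : 0 < k)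
    (hA : ((-k : ℤ) : WithTop ℤ) ≤ v A) : ((-k + 1 : ℤ) : WithTop ℤ) ≤ v x := by
  have hp : 2 ≤ p := (Fact.out : p.Prime).two_le
  by_cases hx : x = 0
  · simp [hx]
  obtain ⟨e, he⟩ := exists_val_eq v hx
  rw [he, WithTop.coe_le_coe]
  by_contra hlt
  have hp' : (2 : ℤ) ≤ p := by exact_mod_cast hp
  have h3 : v (x ^ p) = ((p * e : ℤ) : WithTop ℤ) := val_pow_eq v he p
  have h4 : v (x ^ p + -x) = ((p * e : ℤ) : WithTop ℤ) :=
    val_add_eq_left v h3 (by rw [v.map_neg, he, WithTop.coe_le_coe]; nlinarith)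
  rw [← sub_eq_add_neg, h] at h4
  rw [h4, WithTop.coe_le_coe] at hA
  nlinarith

lemma integral_of_pow_eq_self {y : L} (h : y ^ p = y) : ((0 : ℤ) : WithTop ℤ) ≤ v y := by
  by_cases hy : y = 0
  · simp [hy]
  obtain ⟨e, he⟩ := exists_val_eq v hy
  have h1 := val_pow_eq v he p
  rw [h, he, WithTop.coe_inj] at h1
  have hp : (2 : ℤ) ≤ p := by exact_mod_cast (Fact.out : p.Prime).two_le
  rw [he, WithTop.coe_le_coe]
  nlinarith

/-- Automorphisms move an Artin–Schreier generator by an element of the prime field. -/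
lemma aut_sub_pow [CharP L p] {x : L} {A : K} (h : x ^ p - x = algebraMap K L A) (τ : Gal(L/K)) :
    (τ x - x) ^ p = τ x - x := by
  have h1 := congrArg τ h
  rw [map_sub, map_pow, τ.commutes, ← h] at h1
  rw [sub_pow_char]
  linear_combination h1

variable {b r : ℕ} {β : K} {ω : Fin n → F} {ε : Fin n → K} {x : Fin n → L}

/-- If the Artin–Schreier constants are close to `ω i ^ p ^ n * β`, the combination of the
generators with the coefficients of `exists_coeffs` has, after a correction by an element of a
lower stage, the valuation `-b` in the normalization of the stage `j + 1`. The correction removes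
the contribution of the `ε i` with the help of approximate roots. -/
lemma IsTower.exists_generator [CharP F p] [CharP L p] [Algebra (ZMod p) F]
    (h : IsTower p v σ) (hF : IsConstField v F) (hperf : ∀ c : F, ∃ d : F, d ^ p = c)
    (hb : 0 < b) (hω : LinearIndependent (ZMod p) ω)
    (hβ : v (algebraMap K L β) = ((-((p : ℤ) ^ n * b) : ℤ) : WithTop ℤ)) (hr : r + 2 ≤ n)
    (hε : ∀ i, ((-((p : ℤ) ^ n * b) + 1 : ℤ) : WithTop ℤ) ≤
      v (algebraMap K L (ε i) ^ p ^ (n - 1 - r)))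
    (hx : ∀ i, x i ^ p - x i = algebraMap K L (asConst p β ω ε i)) (j : Fin n)
    (hS : ∀ e ≤ (j : ℕ), e ≤ r → StageGain p b v σ e) :
    ∃ c : Fin n → F, c j = 1 ∧ (∀ i, j < i → c i = 0) ∧ ∃ κ ∈ stage σ r, κ ∈ stage σ j ∧
      v (∑ i, algebraMap F L (c i) * x i - κ) =
        ((-((p : ℤ) ^ (n - (j + 1)) * b) : ℤ) : WithTop ℤ) ∧
      ∀ τ : Gal(L/K), ((0 : ℤ) : WithTop ℤ) ≤ v (τ (∑ i, algebraMap F L (c i) * x i - κ) -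
        (∑ i, algebraMap F L (c i) * x i - κ)) := by
  have hp : p.Prime := Fact.out
  have hp1 : (1 : ℤ) ≤ p := by exact_mod_cast hp.pos
  have hj : (j : ℕ) + 1 ≤ n := j.2
  have hpb : (0 : ℤ) < (p : ℤ) ^ n * b := by positivity
  obtain ⟨c, hc1, hc2, hc3, hc4⟩ := exists_coeffs hω j
  have hεroot : ∀ i, ((-((p : ℤ) ^ (n - 1) * b) : ℤ) : WithTop ℤ) ≤ v (algebraMap K L (ε i)) := by
    intro i
    have h1 := le_val_pow_of_le (a := 1) hp.pos (by omega) (by omega) (hε i)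
    rw [pow_one] at h1
    refine le_val_of_pow v hp.pos (le_val_of_le v h1 ?_)
    have : (p : ℤ) ^ n = p * (p : ℤ) ^ (n - 1) := by
      rw [← pow_succ', Nat.sub_add_cancel (by omega)]
    rw [this]
    linarith
  set J : ℕ := j + 1 with hJ
  -- the error terms of the `p ^ J`-th power are `p ^ s`-th powers of the following elements of `K`
  set E : ℕ → K := fun s => ∑ i, algebraMap F K (c i) ^ p ^ (J - s) * ε i with hE
  have hEL : ∀ s, algebraMap K L (E s) =
      ∑ i, algebraMap F L (c i) ^ p ^ (J - s) * algebraMap K L (ε i) := by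
    intro s
    simp only [hE, map_sum, map_mul, map_pow, ← IsScalarTower.algebraMap_apply F K L]
  have hconst : ∀ (c : F) (q : ℕ), ((0 : ℤ) : WithTop ℤ) ≤ v (algebraMap F L c ^ q) := by
    intro c q
    rw [← map_pow]; exact hF.le_val_const _
  have hEroot : ∀ s, ((-((p : ℤ) ^ (n - 1) * b) : ℤ) : WithTop ℤ) ≤ v (algebraMap K L (E s)) := by
    intro s
    rw [hEL]
    refine v.map_le_sum fun i _ => ?_
    simpa using le_val_mul v (hconst (c i) (p ^ (J - s))) (hεroot i)
  have hκ : ∀ s : ℕ, ∃ κ : L, κ ∈ stage σ r ∧ κ ∈ stage σ j ∧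
      (s < J → ((-((p : ℤ) ^ n * b) + 1 : ℤ) : WithTop ℤ) ≤
        v (algebraMap K L (E s) ^ p ^ s - κ ^ p ^ J)) ∧
      ∀ τ : Gal(L/K), ((0 : ℤ) : WithTop ℤ) ≤ v (τ κ - κ) := by
    intro s
    rcases le_or_gt s (n - 1 - r) with hs | hs
    · -- small Frobenius powers of the `ε i` need no correction
      refine ⟨0, zero_mem _, zero_mem _, fun _ => ?_, by simp⟩
      rw [zero_pow (pow_ne_zero _ hp.ne_zero), sub_zero, hEL, sum_pow_char_pow]
      refine v.map_le_sum fun i _ => ?_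
      rw [mul_pow, ← pow_mul]
      simpa using le_val_mul v (hconst (c i) _)
        (le_val_pow_of_le hp.pos hs (by omega) (hε i))
    · by_cases hsJ : s < J
      · obtain ⟨κ, hκ1, hκ2, hκ3⟩ := h.exists_root (e := J - s) hF hperf (by omega)
          (fun e' he' => hS e' (by omega) (by omega)) (hEroot s)
        refine ⟨κ, stage_mono σ (by omega) hκ1, stage_mono σ (by omega) hκ1, fun _ => ?_,
          fun τ => ?_⟩
        · have h1 : algebraMap K L (E s) ^ p ^ s - κ ^ p ^ J =
              -(κ ^ p ^ (J - s) - algebraMap K L (E s)) ^ p ^ s := by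
            rw [sub_pow_char_pow, ← pow_mul, ← pow_add, Nat.sub_add_cancel hsJ.le]; ring
          rw [h1, v.map_neg]
          exact le_val_of_le v (le_val_pow v hκ2 _) (by simp; omega)
        · have h2 := hS (J - s) (by omega) (by omega) τ κ hκ1 _ hκ3
          refine le_val_of_le v h2 ?_
          rw [show n - (J - s) = n - (J - s + 1) + 1 by omega, pow_succ]
          have : (0 : ℤ) ≤ (p : ℤ) ^ (n - (J - s + 1)) * b := by positivity
          nlinarith
      · exact ⟨0, zero_mem _, zero_mem _, fun h => absurd h hsJ, by simp⟩
  choose κ hκr hκj hκv hκτ using hκ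
  have hx' : ∀ i, x i ^ p - x i =
      algebraMap F L (ω i) ^ p ^ n * algebraMap K L β + algebraMap K L (ε i) := by
    intro i
    rw [hx, asConst, map_add, map_mul, map_pow, ← IsScalarTower.algebraMap_apply F K L]
  refine ⟨c, hc1, hc2, ∑ s ∈ Finset.range J, κ s, sum_mem fun s _ => hκr s,
    sum_mem fun s _ => hκj s, ?_, fun τ => ?_⟩
  · refine val_eq_of_pow v (pow_pos hp.pos J) ?_
    have hexp : ((p ^ J : ℕ) : ℤ) * (-((p : ℤ) ^ (n - J) * b)) = -((p : ℤ) ^ n * b) := by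
      have : (p : ℤ) ^ n = (p : ℤ) ^ J * (p : ℤ) ^ (n - J) := by
        rw [← pow_add, Nat.add_sub_cancel' hj]
      rw [this]; push_cast; ring
    rw [hexp, sub_pow_char_pow, combination_pow hj hx' (fun s hs hs' => hc4 s hs (by omega))
      (Nat.succ_pos j), add_sub_assoc]
    refine val_add_eq_left v ?_ ?_
    · refine val_eq_congr v (val_mul_eq v (hF.val_const (pow_ne_zero _ hc3)) hβ) (zero_add _)
    · rw [add_sub_assoc, sum_pow_char_pow, ← Finset.sum_sub_distrib]
      refine v.map_le_add (v.map_le_sum fun i _ => ?_) (v.map_le_sum fun s hs => ?_)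
      · have h1 : ((-((p : ℤ) ^ n * b) : ℤ) : WithTop ℤ) ≤ v (algebraMap K L (asConst p β ω ε i)) := by
          rw [← hx i, hx' i, ← map_pow]
          refine v.map_le_add ?_ (le_val_of_le v (hεroot i) ?_)
          · simpa using le_val_mul v (hF.le_val_const (ω i ^ p ^ n)) hβ.ge
          · have : (p : ℤ) ^ (n - 1) ≤ (p : ℤ) ^ n := pow_le_pow_right₀ hp1 (by omega)
            nlinarith
        simpa using le_val_mul v (hconst (c i) _) (le_val_of_artinSchreier (hx i) hpb h1)
      · rw [← hEL]
        exact hκv s (Finset.mem_range.1 hs)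
  · have h1 : τ (∑ i, algebraMap F L (c i) * x i - ∑ s ∈ Finset.range J, κ s) -
        (∑ i, algebraMap F L (c i) * x i - ∑ s ∈ Finset.range J, κ s) =
        ∑ i, algebraMap F L (c i) * (τ (x i) - x i) - ∑ s ∈ Finset.range J, (τ (κ s) - κ s) := by
      simp only [map_sub, map_sum, map_mul, fixed_const, mul_sub, Finset.sum_sub_distrib]
      ring
    rw [h1]
    refine v.map_le_sub (v.map_le_sum fun i _ => ?_) (v.map_le_sum fun s _ => hκτ s τ)
    simpa using le_val_mul v (hF.le_val_const (c i))
      (integral_of_pow_eq_self (v := v) (aut_sub_pow (hx i) τ))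

/-- By induction over the stages: a generator of the next stage is obtained from the gain on the
lower stages, and yields the gain on the next stage. -/
lemma IsTower.stageGain [CharP F p] [CharP L p] [Algebra (ZMod p) F]
    (h : IsTower p v σ) (hF : IsConstField v F) (hperf : ∀ c : F, ∃ d : F, d ^ p = c)
    (hb : 0 < b) (hpb : ¬ p ∣ b) (hω : LinearIndependent (ZMod p) ω)
    (hβ : v (algebraMap K L β) = ((-((p : ℤ) ^ n * b) : ℤ) : WithTop ℤ)) (hr : r + 2 ≤ n)
    (hε : ∀ i, ((-((p : ℤ) ^ n * b) + 1 : ℤ) : WithTop ℤ) ≤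
      v (algebraMap K L (ε i) ^ p ^ (n - 1 - r)))
    (hx : ∀ i, x i ^ p - x i = algebraMap K L (asConst p β ω ε i))
    (hσx : ∀ i j, σ i (x j) = x j + if i = j then 1 else 0) :
    ∀ e ≤ r, StageGain p b v σ e := by
  intro e
  induction e using Nat.strong_induction_on with
  | _ e ih =>
    intro her
    rcases Nat.eq_zero_or_pos e with rfl | he
    · exact h.stageGain_zero b
    obtain ⟨e, rfl⟩ : ∃ e', e = e' + 1 := ⟨e - 1, by omega⟩
    obtain ⟨c, -, hc2, κ, -, hκ, hv, hτ⟩ := h.exists_generator hF hperf hb hω hβ hr hε hx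
      ⟨e, by omega⟩ (fun e' he' _ => ih e' (Nat.lt_succ_of_le he') (by simp at he'; omega))
    refine h.stageGain_succ hF hpb (by omega) (ih e (by omega) (by omega)) ?_ hv hτ
    refine sub_mem (sum_mem fun i _ => ?_) (stage_mono σ (Nat.le_succ e) hκ)
    by_cases hi : (i : ℕ) ≤ e
    · refine mul_mem ?_ (mem_stage.2 fun l hl => ?_)
      · rw [IsScalarTower.algebraMap_apply F K L]; exact IntermediateField.algebraMap_mem _ _
      · rw [hσx, if_neg (fun hli => by subst hli; omega), add_zero]
    · rw [hc2 i (by rw [Fin.lt_def]; simpa using hi), map_zero, zero_mul]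
      exact zero_mem _

end Generators

/-! ### Binomial coefficients below the characteristic -/

section Binomial

variable {L : Type*} [Field L]

lemma binom_zero (x : L) : binom x 0 = 1 := by simp [binom]

lemma smeval_descPochhammer (x : L) (k : ℕ) :
    (descPochhammer ℤ k).smeval x = ∏ j ∈ Finset.range k, (x - (j : L)) := by
  induction k with
  | zero => simp
  | succ k ih =>
    rw [descPochhammer_succ_right, Polynomial.smeval_mul, ih, Finset.prod_range_succ,
      Polynomial.smeval_sub, Polynomial.smeval_X, Polynomial.smeval_natCast]
    simp

lemma factorial_ne_zero_of_lt (L : Type*) [Field L] {p : ℕ} [Fact p.Prime] [CharP L p] {a : ℕ}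
    (ha : a < p) : (a.factorial : L) ≠ 0 := by
  rw [Ne, CharP.cast_eq_zero_iff L p, (Fact.out : p.Prime).dvd_factorial]
  omega

lemma binom_add {p : ℕ} [Fact p.Prime] [CharP L p] {a : ℕ} (ha : a < p) (x y : L) :
    binom (x + y) a = ∑ ij ∈ Finset.HasAntidiagonal.antidiagonal a, binom x ij.1 * binom y ij.2 := by
  have h := Ring.descPochhammer_smeval_add a (Commute.all x y)
  simp only [smeval_descPochhammer] at h
  rw [binom, h, Finset.sum_div]
  refine Finset.sum_congr rfl fun ij hij => ?_
  have hij' := Finset.HasAntidiagonal.mem_antidiagonal.1 hij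
  have h0 := factorial_ne_zero_of_lt L ha
  have h1 := factorial_ne_zero_of_lt L (p := p) (a := ij.1) (by omega)
  have h2 := factorial_ne_zero_of_lt L (p := p) (a := ij.2) (by omega)
  have h3 : ((a.choose ij.1 : ℕ) : L) * (ij.1.factorial : L) * (ij.2.factorial : L) =
      (a.factorial : L) := by
    rw [← Nat.cast_mul, ← Nat.cast_mul, show ij.2 = a - ij.1 by omega,
      Nat.choose_mul_factorial_mul_factorial (by omega)]
  rw [binom, binom]
  field_simp
  rw [← h3]
  ring

lemma binom_add_one {p : ℕ} [Fact p.Prime] [CharP L p] {a : ℕ} (ha : a + 1 < p) (x : L) :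
    binom (x + 1) (a + 1) = binom x (a + 1) + binom x a := by
  have h0 := factorial_ne_zero_of_lt L ha
  have h1 : ((a + 1 : ℕ) : L) ≠ 0 := by
    rw [Nat.factorial_succ, Nat.cast_mul] at h0
    exact left_ne_zero_of_mul h0
  have h2 : (a.factorial : L) ≠ 0 := factorial_ne_zero_of_lt L (p := p) (by omega)
  rw [binom, binom, binom, Finset.prod_range_succ', Finset.prod_range_succ _ a, Nat.factorial_succ]
  have h3 : ∀ j : ℕ, x + 1 - ((j + 1 : ℕ) : L) = x - j := fun j => by push_cast; ring
  simp only [h3]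
  push_cast at h1 ⊢
  field_simp
  ring

lemma map_binom {E L : Type*} [Field E] [Field L] (f : E →+* L) (x : E) (a : ℕ) :
    f (binom x a) = binom (f x) a := by
  simp [binom]

lemma val_binom {F L : Type*} [Field F] [Field L] [Algebra F L] {p : ℕ} [Fact p.Prime] [CharP F p]
    {v : AddValuation L (WithTop ℤ)} (hF : IsConstField v F) {x : L} {k : ℤ} (hk : k < 0)
    (hx : v x = (k : WithTop ℤ)) {a : ℕ} (ha : a < p) :
    v (binom x a) = ((a * k : ℤ) : WithTop ℤ) := by
  have hprod : ∀ a : ℕ, v (∏ j ∈ Finset.range a, (x - (j : L))) = ((a * k : ℤ) : WithTop ℤ) := by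
    intro a
    induction a with
    | zero => simp
    | succ a ih =>
      have h1 : v (x - (a : L)) = (k : WithTop ℤ) := by
        rw [sub_eq_add_neg]
        refine val_add_eq_left v hx ?_
        rw [v.map_neg]
        exact le_val_of_le v (val_natCast_nonneg v a) (by omega)
      rw [Finset.prod_range_succ]
      exact val_eq_congr v (val_mul_eq v ih h1) (by push_cast; ring)
  have hfac := hF.val_const (factorial_ne_zero_of_lt F ha)
  rw [map_natCast] at hfac
  rw [binom]
  exact val_eq_congr v (val_div_eq v (hprod a) hfac) (sub_zero _)

end Binomial

/-! ### Truncated translations -/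

section Translation

variable {F M L : Type*} [Field F] [Field M] [Field L] [Algebra F M] [Algebra M L] [Algebra F L]
  [IsScalarTower F M L]

/-- The action of `F[Gal(L/M)]` on `L`. -/
noncomputable def groupAct : MonoidAlgebra F Gal(L/M) →ₐ[F] Module.End M L :=
  MonoidAlgebra.lift F (Module.End M L) Gal(L/M) (AlgEquiv.toLinearMapHom M L)

lemma groupRingAct_mapRingHom (γ : MonoidAlgebra F Gal(L/M)) (z : L) :
    groupRingAct (MonoidAlgebra.mapRingHom Gal(L/M) (algebraMap F M) γ) z = groupAct γ z := by
  rw [groupRingAct, MonoidAlgebra.lift_mapRingHom_algebraMap]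
  rfl

lemma groupAct_of (g : Gal(L/M)) (z : L) :
    groupAct (MonoidAlgebra.of F Gal(L/M) g) z = g z := by
  rw [groupAct, MonoidAlgebra.lift_of]
  rfl

lemma groupAct_const_mul (γ : MonoidAlgebra F Gal(L/M)) (c : F) (z : L) :
    groupAct γ (algebraMap F L c * z) = algebraMap F L c * groupAct γ z := by
  rw [IsScalarTower.algebraMap_apply F M L, ← Algebra.smul_def, ← Algebra.smul_def, map_smul]

variable {m : ℕ}

/-- Products of binomial coefficients in the translates `X l + s l`. -/
noncomputable def binomProd (X : Fin m → L) (s : Fin m → F) (a : Fin m → ℕ) : L :=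
  ∏ l, binom (X l + algebraMap F L (s l)) (a l)

/-- On the products of binomial coefficients of degree below `p` in each variable, `γ` acts as the
translation of the variables by `s`. -/
def ActsAsTranslation (p : ℕ) (X : Fin m → L) (s : Fin m → F) (γ : MonoidAlgebra F Gal(L/M)) :
    Prop :=
  ∀ a : Fin m → ℕ, (∀ l, a l < p) → groupAct γ (binomProd X (0 : Fin m → F) a) = binomProd X s a

variable {p : ℕ} {X : Fin m → L}

lemma actsAsTranslation_of {g : Gal(L/M)} {s : Fin m → F}
    (hg : ∀ l, g (X l) = X l + algebraMap F L (s l)) :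
    ActsAsTranslation p X s (MonoidAlgebra.of F Gal(L/M) g) := by
  intro a _
  rw [groupAct_of, binomProd, map_prod, binomProd]
  refine Finset.prod_congr rfl fun l _ => ?_
  rw [← hg, Pi.zero_apply, map_zero, add_zero]
  exact map_binom (g : L →+* L) _ _

/-- The translation by `s` is realized by an element of `F[Gal(L/M)]` whose class lies in the span
of the Galois group. -/
def IsRealizable (p : ℕ) (M : Type*) [Field M] [Algebra F M] [Algebra M L] [IsScalarTower F M L]
    (X : Fin m → L) (s : Fin m → F) : Prop :=
  ∃ γ : MonoidAlgebra F Gal(L/M), ActsAsTranslation p X s γ ∧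
    InTruncSpan p p F Gal(L/M) (Ideal.Quotient.mk (augIdeal F Gal(L/M) ^ p) γ)

lemma isRealizable_of {g : Gal(L/M)} {s : Fin m → F}
    (hg : ∀ l, g (X l) = X l + algebraMap F L (s l)) : IsRealizable p M X s :=
  ⟨_, actsAsTranslation_of hg, .of g⟩

variable [Fact p.Prime] [CharP L p]

lemma binomProd_add (s s' : Fin m → F) {a : Fin m → ℕ} (ha : ∀ l, a l < p) :
    binomProd X (s + s') a =
      ∑ κ ∈ Fintype.piFinset fun l => Finset.HasAntidiagonal.antidiagonal (a l),
        algebraMap F L (∏ l, binom (s' l) (κ l).2) * binomProd X s fun l => (κ l).1 := by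
  have h : ∀ l, binom (X l + algebraMap F L ((s + s') l)) (a l) =
      ∑ ij ∈ Finset.HasAntidiagonal.antidiagonal (a l),
        binom (X l + algebraMap F L (s l)) ij.1 * binom (algebraMap F L (s' l)) ij.2 := by
    intro l
    rw [Pi.add_apply, map_add, ← add_assoc]
    exact binom_add (ha l) _ _
  rw [binomProd, Finset.prod_congr rfl fun l _ => h l, Finset.prod_univ_sum]
  refine Finset.sum_congr rfl fun κ _ => ?_
  rw [Finset.prod_mul_distrib, map_prod, mul_comm, binomProd]
  congr 1
  exact Finset.prod_congr rfl fun l _ => (map_binom _ _ _).symm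

/-- Translated products are constant combinations of untranslated ones of smaller degrees, so that
the action on the latter determines the action on the former. -/
lemma ActsAsTranslation.apply {s : Fin m → F} {γ : MonoidAlgebra F Gal(L/M)}
    (h : ActsAsTranslation p X s γ) (s' : Fin m → F) {a : Fin m → ℕ} (ha : ∀ l, a l < p) :
    groupAct γ (binomProd X s' a) = binomProd X (s + s') a := by
  rw [← zero_add s', binomProd_add 0 s' ha, map_sum, zero_add, binomProd_add s s' ha]
  refine Finset.sum_congr rfl fun κ hκ => ?_
  rw [groupAct_const_mul, h]
  intro l
  have h1 := Finset.HasAntidiagonal.mem_antidiagonal.1 (Fintype.mem_piFinset.1 hκ l)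
  have h2 := ha l
  omega

lemma ActsAsTranslation.mul {s s' : Fin m → F} {γ γ' : MonoidAlgebra F Gal(L/M)}
    (h : ActsAsTranslation p X s γ) (h' : ActsAsTranslation p X s' γ') :
    ActsAsTranslation p X (s + s') (γ * γ') := by
  intro a ha
  rw [map_mul, Module.End.mul_apply, h' a ha, h.apply s' ha]

lemma binomProd_single_update (i : Fin m) (c : F) (a : Fin m → ℕ) (q : ℕ) :
    binomProd X (Pi.single i c : Fin m → F) (Function.update a i q) =
      binom (X i + algebraMap F L c) q * ∏ l ∈ Finset.univ.erase i, binom (X l) (a l) := by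
  rw [binomProd, ← Finset.mul_prod_erase _ _ (Finset.mem_univ i)]
  congr 1
  · simp
  · refine Finset.prod_congr rfl fun l hl => ?_
    have hl' := (Finset.mem_erase.1 hl).1
    rw [Pi.single_eq_of_ne hl', Function.update_of_ne hl', map_zero, add_zero]

lemma binomProd_update (i : Fin m) (a : Fin m → ℕ) (q : ℕ) :
    binomProd X (0 : Fin m → F) (Function.update a i q) =
      binom (X i) q * ∏ l ∈ Finset.univ.erase i, binom (X l) (a l) := by
  have h := binomProd_single_update (F := F) (X := X) i 0 a q
  rwa [Pi.single_zero, map_zero, add_zero] at h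

/-- `γ - 1` lowers the degree in the `i`-th variable by one if `γ` translates this variable
by `1`. -/
lemma ActsAsTranslation.sub_one_apply {i : Fin m} {γ : MonoidAlgebra F Gal(L/M)}
    (h : ActsAsTranslation p X (Pi.single i 1 : Fin m → F) γ) {a : Fin m → ℕ} (ha : ∀ l, a l < p) :
    groupAct (γ - 1) (binomProd X (0 : Fin m → F) a) =
      if 1 ≤ a i then binomProd X (0 : Fin m → F) (Function.update a i (a i - 1)) else 0 := by
  have h1 : groupAct (γ - 1) (binomProd X (0 : Fin m → F) a) =
      binomProd X (Pi.single i 1 : Fin m → F) a - binomProd X (0 : Fin m → F) a := by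
    rw [map_sub, map_one, LinearMap.sub_apply, Module.End.one_apply, h a ha]
  rw [h1]
  have h2 := binomProd_single_update (F := F) (X := X) i 1 a (a i)
  have h3 := binomProd_update (F := F) (X := X) i a (a i)
  rw [Function.update_eq_self] at h2 h3
  rw [h2, h3, map_one]
  split_ifs with hi
  · obtain ⟨q, hq⟩ : ∃ q, a i = q + 1 := ⟨a i - 1, by omega⟩
    rw [binomProd_update, hq, binom_add_one (p := p) (by have := ha i; omega), Nat.add_sub_cancel]
    ring
  · rw [show a i = 0 by omega, binom_zero, binom_zero, sub_self]

lemma ActsAsTranslation.sub_one_pow_apply {i : Fin m} {γ : MonoidAlgebra F Gal(L/M)}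
    (h : ActsAsTranslation p X (Pi.single i 1 : Fin m → F) γ) {a : Fin m → ℕ} (ha : ∀ l, a l < p)
    (k : ℕ) : groupAct ((γ - 1) ^ k) (binomProd X (0 : Fin m → F) a) =
      if k ≤ a i then binomProd X (0 : Fin m → F) (Function.update a i (a i - k)) else 0 := by
  induction k with
  | zero => simp
  | succ k ih =>
    rw [pow_succ', map_mul, Module.End.mul_apply, ih]
    split_ifs with h1 h2 h2
    · have ha' : ∀ l, Function.update a i (a i - k) l < p := by
        intro l
        rcases eq_or_ne l i with rfl | hl
        · rw [Function.update_self]; have := ha l; omega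
        · rw [Function.update_of_ne hl]; exact ha l
      rw [h.sub_one_apply ha', Function.update_self, if_pos (by omega), Function.update_idem,
        Nat.sub_sub]
    · rw [h.sub_one_apply, Function.update_self, if_neg (by omega)]
      intro l
      rcases eq_or_ne l i with rfl | hl
      · rw [Function.update_self]; have := ha l; omega
      · rw [Function.update_of_ne hl]; exact ha l
    · omega
    · rw [map_zero]

/-- The truncated power of a translation by `1` in one variable is the translation by the exponent,
because the degree in this variable is less than `p`. -/
lemma ActsAsTranslation.truncPow {i : Fin m} {γ : MonoidAlgebra F Gal(L/M)}
    (h : ActsAsTranslation p X (Pi.single i 1 : Fin m → F) γ) (c : F) :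
    ActsAsTranslation p X (Pi.single i c : Fin m → F) (truncPow p γ c) := by
  intro a ha
  have h1 := binomProd_single_update (F := F) (X := X) i c a (a i)
  rw [Function.update_eq_self] at h1
  rw [AS.truncPow, map_sum, LinearMap.sum_apply, h1, add_comm (X i), binom_add (ha i),
    Finset.Nat.sum_antidiagonal_eq_sum_range_succ_mk, Finset.sum_mul]
  have h2 : ∀ k ∈ Finset.range p, groupAct (binom c k • (γ - 1) ^ k)
      (binomProd X (0 : Fin m → F) a) = if k < a i + 1 then
        binom (algebraMap F L c) k * binom (X i) (a i - k) *
          ∏ l ∈ Finset.univ.erase i, binom (X l) (a l) else 0 := by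
    intro k _
    rw [map_smul, LinearMap.smul_apply, h.sub_one_pow_apply ha, Algebra.smul_def, map_binom]
    simp only [Nat.lt_succ_iff]
    split_ifs with hk
    · rw [binomProd_update, mul_assoc]
    · rw [mul_zero]
  rw [Finset.sum_congr rfl h2, ← Finset.sum_filter]
  refine Finset.sum_congr ?_ fun k _ => rfl
  ext k
  have := ha i
  simp only [Finset.mem_filter, Finset.mem_range]
  omega

lemma IsRealizable.add {s s' : Fin m → F} (h : IsRealizable p M X s)
    (h' : IsRealizable p M X s') : IsRealizable p M X (s + s') := by
  obtain ⟨γ, h1, h2⟩ := h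
  obtain ⟨γ', h1', h2'⟩ := h'
  exact ⟨γ * γ', h1.mul h1', by rw [map_mul]; exact h2.mul h2'⟩

lemma IsRealizable.single {i : Fin m} (h : IsRealizable p M X (Pi.single i 1 : Fin m → F))
    (c : F) : IsRealizable p M X (Pi.single i c : Fin m → F) := by
  obtain ⟨γ, h1, h2⟩ := h
  refine ⟨AS.truncPow p γ c, h1.truncPow c, ?_⟩
  have h3 : Ideal.Quotient.mk (augIdeal F Gal(L/M) ^ p) (AS.truncPow p γ c) =
      AS.truncPow p (Ideal.Quotient.mk (augIdeal F Gal(L/M) ^ p) γ) c := by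
    rw [AS.truncPow, AS.truncPow, map_sum]
    refine Finset.sum_congr rfl fun k _ => ?_
    rw [← map_one (Ideal.Quotient.mk (augIdeal F Gal(L/M) ^ p)), ← map_sub, ← map_pow]
    rfl
  rw [h3]
  exact h2.pow c

lemma isRealizable_sum (t : Finset (Fin m)) (d : Fin m → F)
    (h : ∀ i ∈ t, IsRealizable p M X (Pi.single i 1 : Fin m → F)) :
    IsRealizable p M X (∑ i ∈ t, Pi.single i (d i) : Fin m → F) := by
  classical
  induction t using Finset.induction_on with
  | empty => exact isRealizable_of (g := 1) (by simp)
  | insert i t hi ih =>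
    rw [Finset.sum_insert hi]
    exact ((h i (Finset.mem_insert_self i t)).single _).add
      (ih fun j hj => h j (Finset.mem_insert_of_mem hj))

/-- Automorphisms that act on the variables by unitriangular translations can be corrected by
truncated powers, starting from the last variable, to translations of a single variable. -/
lemma isRealizable_single (A : Fin m → Fin m → F) (g : Fin m → Gal(L/M))
    (hg : ∀ i l, g i (X l) = X l + algebraMap F L (A i l)) (hdiag : ∀ i, A i i = 1)
    (hlow : ∀ i l, l < i → A i l = 0) (i : Fin m) :
    IsRealizable p M X (Pi.single i 1 : Fin m → F) := by
  induction i using WellFoundedGT.induction with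
  | _ i ih =>
    have h1 := (isRealizable_of (p := p) (hg i)).add
      (isRealizable_sum (Finset.univ.filter (i < ·)) (fun l => -A i l)
        fun l hl => ih l (Finset.mem_filter.1 hl).2)
    convert h1 using 1
    ext l
    rw [Pi.add_apply, Finset.sum_apply]
    have h2 : ∀ j ∈ Finset.univ.filter (i < ·), (Pi.single j (-A i j) : Fin m → F) l =
        if l = j then -A i l else 0 := by
      intro j _
      rw [Pi.single_apply]
      split_ifs with hlj
      · rw [hlj]
      · rfl
    rw [Finset.sum_congr rfl h2, Finset.sum_ite_eq]
    rcases lt_trichotomy l i with hl | rfl | hl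
    · rw [Pi.single_eq_of_ne hl.ne, hlow i l hl, if_neg (by simpa using hl.le), add_zero]
    · rw [Pi.single_eq_same, hdiag, if_neg (by simp), add_zero]
    · rw [Pi.single_eq_of_ne hl.ne', if_pos (by simpa using hl), add_neg_cancel]

end Translation

/-! ### The scaffold -/

section Digits

lemma sum_digits (p N m : ℕ) :
    ∑ j ∈ Finset.range m, N / p ^ j % p * p ^ j = N % p ^ m := by
  induction m with
  | zero => simp [Nat.mod_one]
  | succ m ih => rw [Finset.sum_range_succ, ih, Nat.mod_pow_succ, mul_comm]

/-- Subtracting `p ^ j` lowers a nonzero `j`-th digit by one and does not change the others. -/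
lemma digit_sub_pow {p : ℕ} (hp : 0 < p) {N j : ℕ} (h : 1 ≤ N / p ^ j % p) (i : ℕ) :
    (N - p ^ j) / p ^ i % p = if i = j then N / p ^ j % p - 1 else N / p ^ i % p := by
  have hpj : ∀ j, 0 < p ^ j := fun j => pow_pos hp j
  have hdiv : (N - p ^ j) / p ^ j = N / p ^ j - 1 := by
    have := Nat.sub_mul_div N (p ^ j) 1
    rwa [mul_one] at this
  split_ifs with hij
  · subst hij
    rw [hdiv]
    obtain ⟨q, d, hd, hN⟩ : ∃ q d, N / p ^ i % p = d ∧ N / p ^ i = p * q + d :=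
      ⟨_, _, rfl, (Nat.div_add_mod _ _).symm⟩
    have hdp : d < p := hd ▸ Nat.mod_lt _ hp
    rw [hd] at h ⊢
    rw [hN, Nat.add_sub_assoc h, Nat.mul_add_mod, Nat.mod_eq_of_lt (by omega)]
  · rcases lt_or_gt_of_ne hij with hlt | hlt
    · obtain ⟨k, rfl⟩ : ∃ k, j = i + (k + 1) := ⟨j - i - 1, by omega⟩
      have h1 : (N - p ^ (i + (k + 1))) / p ^ i = N / p ^ i - p ^ (k + 1) := by
        rw [pow_add]; exact Nat.sub_mul_div N (p ^ i) (p ^ (k + 1))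
      have h2 : p ^ (k + 1) ≤ N / p ^ i := by
        rw [Nat.le_div_iff_mul_le (hpj i), ← pow_add, add_comm]
        by_contra hN
        rw [Nat.div_eq_of_lt (not_le.1 hN)] at h
        simp at h
      rw [h1]
      obtain ⟨q, hq⟩ : ∃ q, N / p ^ i = q + p ^ (k + 1) := ⟨_, (Nat.sub_add_cancel h2).symm⟩
      rw [hq, Nat.add_sub_cancel, pow_succ, Nat.add_mul_mod_self_right]
    · obtain ⟨k, rfl⟩ : ∃ k, i = j + 1 + k := ⟨i - j - 1, by omega⟩
      rw [pow_add, pow_succ, ← Nat.div_div_eq_div_mul, ← Nat.div_div_eq_div_mul, hdiv,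
        ← Nat.div_div_eq_div_mul, ← Nat.div_div_eq_div_mul]
      congr 2
      obtain ⟨q, d, hd, hN⟩ : ∃ q d, N / p ^ j % p = d ∧ N / p ^ j = p * q + d :=
        ⟨_, _, rfl, (Nat.div_add_mod _ _).symm⟩
      have hdp : d < p := hd ▸ Nat.mod_lt _ hp
      rw [hd] at h
      rw [hN, Nat.add_sub_assoc h, Nat.mul_add_div hp, Nat.mul_add_div hp,
        Nat.div_eq_of_lt hdp, Nat.div_eq_of_lt (by omega)]

/-- The representative in `[0, p ^ m)` of `-b⁻¹ w` modulo `p ^ m`. -/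
def residueIndex (p b m : ℕ) (w : ℤ) : ℕ :=
  (-(b : ZMod (p ^ m))⁻¹ * (w : ZMod (p ^ m))).val

variable {p b m : ℕ}

lemma residueIndex_congr {w w' : ℤ} (h : w ≡ w' [ZMOD ((p ^ m : ℕ) : ℤ)]) :
    residueIndex p b m w = residueIndex p b m w' := by
  rw [residueIndex, residueIndex, (ZMod.intCast_eq_intCast_iff w w' (p ^ m)).2 h]

variable [Fact p.Prime]

lemma residueIndex_lt (w : ℤ) : residueIndex p b m w < p ^ m :=
  haveI : NeZero (p ^ m) := ⟨pow_ne_zero _ (Fact.out : p.Prime).ne_zero⟩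
  ZMod.val_lt _

lemma dvd_add_mul_residueIndex (hb : ¬ p ∣ b) (w : ℤ) :
    ((p ^ m : ℕ) : ℤ) ∣ w + b * residueIndex p b m w := by
  have : NeZero (p ^ m) := ⟨pow_ne_zero _ (Fact.out : p.Prime).ne_zero⟩
  rw [← ZMod.intCast_zmod_eq_zero_iff_dvd]
  push_cast
  rw [residueIndex, ZMod.natCast_val, ZMod.cast_id, neg_mul, mul_neg, ← mul_assoc,
    ZMod.coe_mul_inv_eq_one, one_mul, add_neg_cancel]
  exact (((Nat.Prime.coprime_iff_not_dvd Fact.out).2 hb).symm).pow_right m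

lemma residueIndex_add (hb : ¬ p ∣ b) {w : ℤ} {q : ℕ} (hq : q ≤ residueIndex p b m w) :
    residueIndex p b m (w + ((q * b : ℕ) : ℤ)) = residueIndex p b m w - q := by
  have : NeZero (p ^ m) := ⟨pow_ne_zero _ (Fact.out : p.Prime).ne_zero⟩
  have h1 : (b : ZMod (p ^ m)) * (b : ZMod (p ^ m))⁻¹ = 1 :=
    ZMod.coe_mul_inv_eq_one _ ((((Nat.Prime.coprime_iff_not_dvd Fact.out).2 hb).symm).pow_right m)
  have h2 : -(b : ZMod (p ^ m))⁻¹ * ((w + ((q * b : ℕ) : ℤ) : ℤ) : ZMod (p ^ m)) =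
      ((residueIndex p b m w - q : ℕ) : ZMod (p ^ m)) := by
    rw [Nat.cast_sub hq, residueIndex, ZMod.natCast_val, ZMod.cast_id]
    push_cast
    linear_combination -(q : ZMod (p ^ m)) * h1
  rw [residueIndex, h2, ZMod.val_natCast, Nat.mod_eq_of_lt]
  have := residueIndex_lt (p := p) (b := b) (m := m) w
  omega

end Digits

section Scaffold

variable {F M L : Type*} [Field F] [Field M] [Field L] [Algebra F M] [Algebra M L] [Algebra F L]
  [IsScalarTower F M L] {p b m : ℕ} [Fact p.Prime] [CharP F p] [CharP L p]

/-- Elements `X l` of valuation `-p ^ (m - 1 - l) b` on which `L/M` acts by unitriangular constant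
translations yield a scaffold: the products of binomial coefficients in the `X l`, scaled
by elements of `M`, have all valuations, and translating a single variable by `1` lowers one
digit. -/
lemma exists_scaffold {v : AddValuation L (WithTop ℤ)} (hF : IsConstField v F) (hb : 0 < b)
    (hpb : ¬ p ∣ b) (hM : ∀ k : ℤ, ∃ t : M, v (algebraMap M L t) = (((p : ℤ) ^ m * k : ℤ) : WithTop ℤ))
    {X : Fin m → L}
    (hX : ∀ l : Fin m, v (X l) = ((-((p : ℤ) ^ (m - 1 - (l : ℕ)) * b) : ℤ) : WithTop ℤ))
    (A : Fin m → Fin m → F) (g : Fin m → Gal(L/M))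
    (hg : ∀ i l, g i (X l) = X l + algebraMap F L (A i l)) (hdiag : ∀ i, A i i = 1)
    (hlow : ∀ i l, l < i → A i l = 0) :
    ∃ (lam : ℤ → L) (Ψ : Fin m → MonoidAlgebra F Gal(L/M)),
      IsGaloisScaffold p b m v lam
        (fun i => MonoidAlgebra.mapRingHom Gal(L/M) (algebraMap F M) (Ψ i)) ∧
      ∀ i, InTruncSpan p p F Gal(L/M)
        (Ideal.Quotient.mk (augIdeal F Gal(L/M) ^ p) (1 + Ψ i)) := by
  have hp : p.Prime := Fact.out
  choose γ hγ hspan using isRealizable_single (p := p) A g hg hdiag hlow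
  choose t ht using hM
  have ht0 : ∀ k, t k ≠ 0 := fun k h0 => ne_zero_of_val_eq v (ht k) (by simp [h0])
  set a : ℤ → Fin m → ℕ := fun w l => residueIndex p b m w / p ^ (m - 1 - (l : ℕ)) % p with ha
  have hap : ∀ w l, a w l < p := fun w l => Nat.mod_lt _ hp.pos
  set k : ℤ → ℤ := fun w => (w + b * residueIndex p b m w) / ((p ^ m : ℕ) : ℤ) with hk
  have hkw : ∀ w, (p : ℤ) ^ m * k w = w + b * residueIndex p b m w := by
    intro w
    have := Int.mul_ediv_cancel' (dvd_add_mul_residueIndex (m := m) hpb w)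
    rw [← this]; push_cast; rfl
  set lam : ℤ → L := fun w => algebraMap M L (t (k w)) * binomProd X (0 : Fin m → F) (a w) with hlam
  have hsum : ∀ w, ∑ l : Fin m, (a w l : ℤ) * (p : ℤ) ^ (m - 1 - (l : ℕ)) =
      residueIndex p b m w := by
    intro w
    have h1 := sum_digits p (residueIndex p b m w) m
    rw [Nat.mod_eq_of_lt (residueIndex_lt w), ← Finset.sum_range_reflect,
      ← Fin.sum_univ_eq_sum_range (fun l => residueIndex p b m w / p ^ (m - 1 - l) % p *
        p ^ (m - 1 - l))] at h1
    rw [← h1]; push_cast; rfl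
  have hprod : ∀ w, v (binomProd X (0 : Fin m → F) (a w)) =
      ((-(b * residueIndex p b m w) : ℤ) : WithTop ℤ) := by
    intro w
    have h1 : ∀ s : Finset (Fin m), v (∏ l ∈ s, binom (X l + algebraMap F L 0) (a w l)) =
        ((∑ l ∈ s, (a w l : ℤ) * (-((p : ℤ) ^ (m - 1 - (l : ℕ)) * b)) : ℤ) : WithTop ℤ) := by
      intro s
      classical
      induction s using Finset.induction_on with
      | empty => simp
      | insert l s hl ih =>
        rw [Finset.prod_insert hl, Finset.sum_insert hl, map_zero, add_zero]
        rw [map_zero] at ih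
        refine val_mul_eq v (val_binom (p := p) hF ?_ (hX l) (hap w l)) ih
        have : (0 : ℤ) < (p : ℤ) ^ (m - 1 - (l : ℕ)) * b :=
          mul_pos (pow_pos (by exact_mod_cast hp.pos) _) (by exact_mod_cast hb)
        omega
    refine val_eq_congr v (h1 Finset.univ) ?_
    rw [← hsum w, Finset.mul_sum, ← Finset.sum_neg_distrib]
    exact Finset.sum_congr rfl fun l _ => by ring
  have hact : ∀ i w, groupAct (γ i - 1) (lam w) = algebraMap M L (t (k w)) *
      (if 1 ≤ a w i then binomProd X (0 : Fin m → F) (Function.update (a w) i (a w i - 1))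
        else 0) := by
    intro i w
    rw [hlam, ← (hγ i).sub_one_apply (hap w)]
    simp only [← Algebra.smul_def, map_smul]
  refine ⟨lam, fun i => γ i - 1, ⟨fun w => ?_, fun w w' hw => ?_, fun i => ?_, fun i w => ?_⟩,
    fun i => by rw [add_sub_cancel]; exact hspan i⟩
  · refine val_eq_congr v (val_mul_eq v (ht (k w)) (hprod w)) ?_
    rw [hkw]; ring
  · have haw : a w = a w' := by
      simp only [ha, residueIndex_congr hw]
    refine ⟨t (k w) * (t (k w'))⁻¹, ?_⟩
    have h0 := ne_zero_of_val_eq v (hprod w')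
    have h1 : algebraMap M L (t (k w')) ≠ 0 := by simpa using ht0 (k w')
    simp only [hlam, haw, map_mul, map_inv₀]
    field_simp
  · rw [groupRingAct_mapRingHom]
    have h1 := (hγ i).sub_one_apply (a := fun _ => 0) (fun _ => hp.pos)
    simpa [binomProd, binom_zero] using h1
  · refine ⟨1, by simp, ?_⟩
    rw [groupRingAct_mapRingHom, hact, map_one, one_mul]
    change _ = if 1 ≤ a w i then _ else _
    split_ifs with hi
    · have hle : p ^ (m - 1 - (i : ℕ)) ≤ residueIndex p b m w := by
        by_contra hlt
        simp only [ha, Nat.div_eq_of_lt (not_le.1 hlt)] at hi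
        simp at hi
      have hres := residueIndex_add hpb hle
      have hk' : k (w + ((p ^ (m - 1 - (i : ℕ)) * b : ℕ) : ℤ)) = k w := by
        simp only [hk, hres]
        congr 1
        rw [Nat.cast_sub hle]
        push_cast
        ring
      have ha' : a (w + ((p ^ (m - 1 - (i : ℕ)) * b : ℕ) : ℤ)) =
          Function.update (a w) i (a w i - 1) := by
        ext l
        simp only [ha, hres]
        rw [digit_sub_pow hp.pos hi]
        rcases eq_or_ne l i with rfl | hl
        · rw [if_pos rfl, Function.update_self]
        · rw [Function.update_of_ne hl, if_neg]
          intro h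
          exact hl (Fin.ext (by omega))
      simp only [hlam, hk', ha']
    · rw [mul_zero]

end Scaffold

/-! ### The Galois group of an Artin–Schreier extension -/

section Galois

variable {K L : Type*} [Field K] [Field L] [Algebra K L] {n p : ℕ} [Fact p.Prime] [CharP L p]

lemma exists_zmod_of_pow_eq_self {y : L} (h : y ^ p = y) :
    ∃ t : ZMod p, ZMod.castHom dvd_rfl L t = y := by
  have h1 := (Subfield.mem_bot_iff_pow_eq_self (F := L) (p := p)).2 h
  rw [← ZMod.fieldRange_castHom_eq_bot p] at h1
  exact h1

variable {x : Fin n → L} {A : Fin n → K}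

/-- Roots of the same Artin–Schreier equation generate the same field, so that some of the
generators may be exchanged. -/
lemma adjoin_exchange (hx : ∀ i, x i ^ p - x i = algebraMap K L (A i)) {x' : Fin n → L}
    (hx' : ∀ i, x' i ^ p - x' i = algebraMap K L (A i))
    (hgen : IntermediateField.adjoin K (Set.range x') = ⊤) :
    IntermediateField.adjoin K (Set.range x) = ⊤ := by
  rw [eq_top_iff, ← hgen, IntermediateField.adjoin_le_iff]
  rintro _ ⟨i, rfl⟩
  have h1 : (x' i - x i) ^ p = x' i - x i := by
    rw [sub_pow_char]
    linear_combination hx' i - hx i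
  obtain ⟨t, ht⟩ := exists_zmod_of_pow_eq_self h1
  have h2 : x' i = x i + ZMod.castHom dvd_rfl L t := by rw [ht]; ring
  have h3 : ZMod.castHom dvd_rfl L t = ((t.val : ℕ) : L) := by
    rw [ZMod.castHom_apply, ZMod.natCast_val]
  rw [h2, h3]
  exact add_mem (IntermediateField.subset_adjoin K _ ⟨i, rfl⟩) (natCast_mem _ _)

/-- In an Artin–Schreier extension of degree `p ^ n`, the Galois group is dual to the `n`
generators. -/
lemma exists_dual_automorphisms (hx : ∀ i, x i ^ p - x i = algebraMap K L (A i))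
    (hgen : IntermediateField.adjoin K (Set.range x) = ⊤)
    (hcard : Nat.card Gal(L/K) = p ^ n) :
    ∃ σ : Fin n → Gal(L/K), (∀ i j, σ i (x j) = x j + if i = j then 1 else 0) ∧
      ∀ (τ : Gal(L/K)) (r : ℕ), (∀ j : Fin n, (j : ℕ) < r → τ (x j) = x j) →
        ∀ z ∈ stage σ r, τ z = z := by
  have hex : ∀ (τ : Gal(L/K)) (i : Fin n), ∃ t : ZMod p, ZMod.castHom dvd_rfl L t = τ (x i) - x i :=
    fun τ i => exists_zmod_of_pow_eq_self (aut_sub_pow (hx i) τ)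
  choose d hd using hex
  have hτ : ∀ τ i, τ (x i) = x i + ZMod.castHom dvd_rfl L (d τ i) := fun τ i => by
    rw [hd]; ring
  have hfix : ∀ (τ : Gal(L/K)) (t : ZMod p),
      τ (ZMod.castHom dvd_rfl L t) = ZMod.castHom dvd_rfl L t := fun τ t =>
    DFunLike.congr_fun (Subsingleton.elim ((τ : L →+* L).comp (ZMod.castHom dvd_rfl L)) _) t
  have hinj0 : Function.Injective (ZMod.castHom (dvd_refl p) L) := (ZMod.castHom dvd_rfl L).injective
  let Φ : Gal(L/K) →* Multiplicative (Fin n → ZMod p) :=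
    { toFun := fun τ => Multiplicative.ofAdd (d τ)
      map_one' := by
        refine congrArg Multiplicative.ofAdd (funext fun i => hinj0 ?_)
        rw [hd]; simp
      map_mul' := fun τ τ' => by
        refine congrArg Multiplicative.ofAdd (funext fun i => hinj0 ?_)
        change _ = ZMod.castHom dvd_rfl L (d τ i + d τ' i)
        rw [map_add, hd, hd, hd, AlgEquiv.mul_apply, hτ τ' i, map_add, hfix, hτ τ i]
        ring }
  have hΦinj : Function.Injective Φ := by
    refine (injective_iff_map_eq_one Φ).2 fun τ h => ?_
    have h1 : d τ = 0 := Multiplicative.ofAdd.injective h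
    ext z
    have hz : z ∈ IntermediateField.adjoin K (Set.range x) := by rw [hgen]; trivial
    induction hz using IntermediateField.adjoin_induction with
    | mem z hz => obtain ⟨i, rfl⟩ := hz; rw [hτ, h1]; simp
    | algebraMap a => simp
    | add y z _ _ hy hz => rw [map_add, map_add, hy, hz]
    | inv z _ hz => rw [map_inv₀, map_inv₀, hz]
    | mul y z _ _ hy hz => rw [map_mul, map_mul, hy, hz]
  have hΦ : Function.Bijective Φ := by
    refine hΦinj.bijective_of_nat_card_le (le_of_eq ?_)
    rw [hcard, Nat.card_congr Multiplicative.toAdd]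
    simp
  set e := (MulEquiv.ofBijective Φ hΦ).symm
  have hde : ∀ u, d (e (Multiplicative.ofAdd u)) = u := fun u =>
    Multiplicative.ofAdd.injective ((MulEquiv.ofBijective Φ hΦ).apply_symm_apply _)
  refine ⟨fun i => e (Multiplicative.ofAdd (Pi.single i 1)), fun i j => ?_, fun τ r hr z hz => ?_⟩
  · rw [hτ, hde, Pi.single_apply]
    simp only [eq_comm (a := j) (b := i)]
    split_ifs <;> simp
  · have hz' := mem_stage.1 hz
    have hdτ : ∀ j : Fin n, (j : ℕ) < r → d τ j = 0 := fun j hj => hinj0 (by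
      rw [hd, hr j hj, sub_self, map_zero])
    have hτe : e (Multiplicative.ofAdd (d τ)) = τ :=
      (MulEquiv.ofBijective Φ hΦ).symm_apply_apply τ
    have key : ∀ s : Finset (Fin n),
        e (Multiplicative.ofAdd (∑ i ∈ s, Pi.single i (d τ i) : Fin n → ZMod p)) z = z := by
      intro s
      classical
      induction s using Finset.induction_on with
      | empty => simp
      | insert i s hi ih =>
        rw [Finset.sum_insert hi, ofAdd_add, map_mul, AlgEquiv.mul_apply, ih]
        rcases lt_or_ge (i : ℕ) r with hir | hir
        · simp [hdτ i hir]
        · have h1 : (Pi.single i (d τ i) : Fin n → ZMod p) =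
              (d τ i).val • (Pi.single i 1 : Fin n → ZMod p) := by
            rw [← Pi.single_smul]
            simp
          rw [h1, ofAdd_nsmul, map_pow]
          have h2 : ∀ q : ℕ, (e (Multiplicative.ofAdd (Pi.single i 1 : Fin n → ZMod p)) ^ q) z = z := by
            intro q
            induction q with
            | zero => simp
            | succ q ihq => rw [pow_succ, AlgEquiv.mul_apply, hz' i hir, ihq]
          exact h2 _
    have h3 := key Finset.univ
    rwa [Finset.univ_sum_single, hτe] at h3

end Galois

/-! ### Construction of the generators and the scaffold -/

section Construction

variable {F K L : Type*} [Field F] [Field K] [Field L] [Algebra F K] [Algebra K L]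
  {p n b r : ℕ} [Fact p.Prime]
  {vK : AddValuation K (WithTop ℤ)} {vL : AddValuation L (WithTop ℤ)} {σ : Fin n → Gal(L/K)}

lemma isTower [FiniteDimensional K L] [IsGalois K L] (hK : IsLocalField F vK) (hL : IsTotallyRamified vK vL)
    (hG : Nonempty (Gal(L/K) ≃* Multiplicative (Fin n → ZMod p)))
    (hN : Module.finrank K L = p ^ n)
    (hfix : ∀ (τ : Gal(L/K)), ∀ z ∈ stage σ 0, τ z = z) : IsTower p vL σ where
  val_aut := hL.val_aut hK
  comm i j := by
    obtain ⟨e⟩ := hG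
    apply e.injective
    rw [map_mul, map_mul, mul_comm]
  pow i := by
    obtain ⟨e⟩ := hG
    apply e.injective
    rw [map_pow, map_one, ← ofAdd_toAdd (e (σ i)), ← ofAdd_nsmul]
    refine congrArg Multiplicative.ofAdd (funext fun j => ?_)
    rw [Pi.smul_apply, nsmul_eq_mul, CharP.cast_eq_zero, zero_mul]
    rfl
  bot := by
    rw [eq_bot_iff]
    intro z hz
    exact (IsGalois.mem_bot_iff_fixed z).2 fun τ => hfix τ z hz
  normalized := hL.normalized
  dvd_base z k hz := by
    have hz0 : z ≠ 0 := by rintro rfl; simp at hz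
    obtain ⟨l, hl⟩ := exists_val_eq vK hz0
    rw [hL.val_algebraMap hl, hN, WithTop.coe_inj] at hz
    exact ⟨l, by rw [← hz]; push_cast; rfl⟩

variable [Algebra F L] [IsScalarTower F K L] [CharP F p] [CharP L p]

/-- The two constructions of generators of prescribed valuation: by Moore coefficients and
approximate roots when at least two steps of the tower lie above the stage `r`, and by the break
alone when there is only one. -/
lemma exists_all_generators [FiniteDimensional K L] [Algebra (ZMod p) F] (hK : IsLocalField F vK)
    (hL : IsTotallyRamified vK vL) (hbreak : ramificationBreaks K vL = {(b : ℤ)})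
    (hN : Module.finrank K L = p ^ n) (h : IsTower p vL σ)
    (hperf : ∀ c : F, ∃ d : F, d ^ p = c) (hb : 0 < b) (hpb : ¬ p ∣ b)
    {β : K} {ω : Fin n → F} {ε : Fin n → K} {x : Fin n → L}
    (hω : LinearIndependent (ZMod p) ω) (hβ : vK β = ((-(b : ℤ) : ℤ) : WithTop ℤ))
    (hε : ∀ i, ((-(b : ℤ) : ℤ) : WithTop ℤ) < p ^ (n - 1 - r) • vK (ε i))
    (hx : ∀ i, x i ^ p - x i = algebraMap K L (asConst p β ω ε i))
    (hσx : ∀ i j, σ i (x j) = x j + if i = j then 1 else 0) (j : Fin n) (hrj : r ≤ j) :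
    ∃ c : Fin n → F, c j = 1 ∧ (∀ i, j < i → c i = 0) ∧ ∃ κ ∈ stage σ r,
      vL (∑ i, algebraMap F L (c i) * x i - κ) =
        ((-((p : ℤ) ^ (n - (j + 1)) * b) : ℤ) : WithTop ℤ) := by
  have hF := hL.isConstField hK
  have hp : p.Prime := Fact.out
  have hjn := j.2
  by_cases hr : r + 2 ≤ n
  · have hβ' : vL (algebraMap K L β) = ((-((p : ℤ) ^ n * b) : ℤ) : WithTop ℤ) :=
      val_eq_congr vL (hL.val_algebraMap hβ) (by rw [hN]; push_cast; ring)
    have hε' : ∀ i, ((-((p : ℤ) ^ n * b) + 1 : ℤ) : WithTop ℤ) ≤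
        vL (algebraMap K L (ε i) ^ p ^ (n - 1 - r)) := by
      intro i
      have h1 := hε i
      rw [← vK.map_pow, lt_iff_succ_le] at h1
      rw [← map_pow]
      refine le_val_of_le vL (hL.le_val_algebraMap h1) ?_
      have h2 : (1 : ℤ) ≤ (p : ℤ) ^ n := one_le_pow₀ (by exact_mod_cast hp.pos)
      rw [hN]; push_cast
      linarith
    obtain ⟨c, hc1, hc2, κ, hκ, -, hv, -⟩ := h.exists_generator hF hperf hb hω hβ' hr hε' hx j
      (fun e _ he => h.stageGain hF hperf hb hpb hω hβ' hr hε' hx hσx e he)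
    exact ⟨c, hc1, hc2, κ, hκ, hv⟩
  · obtain rfl : r = j := by omega
    have hj1 : (j : ℕ) + 1 = n := by omega
    have hσj : σ j ≠ 1 := by
      intro h1
      have h2 := hσx j j
      rw [h1, if_pos rfl] at h2
      simp at h2
    obtain ⟨κ, hκ, hv⟩ := h.exists_generator_last (b := b) (z := x j) hF hj1
      (gain_break hK hL hbreak (σ j)) (fun z k hz hk => by
        refine val_sub_eq_break hK hL hbreak hσj hz ?_
        rw [hN]; push_cast
        exact ((Nat.prime_iff_prime_int.1 hp).coprime_iff_not_dvd.2 hk).symm.pow_right)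
      (by rw [hσx, if_pos rfl])
    refine ⟨Pi.single j 1, Pi.single_eq_same _ _, fun i hi => Pi.single_eq_of_ne hi.ne' _, κ, hκ, ?_⟩
    rw [Finset.sum_eq_single_of_mem j (Finset.mem_univ j) fun i _ hi => by
      rw [Pi.single_eq_of_ne hi, map_zero, zero_mul], Pi.single_eq_same, map_one, one_mul,
      show n - ((j : ℕ) + 1) = 0 by omega, pow_zero, one_mul]
    exact hv

/-- Over the stage `r`, the generators of prescribed valuation yield a scaffold. -/
lemma exists_scaffold_stage (hF : IsConstField vL F) (h : IsTower p vL σ) (hb : 0 < b)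
    (hpb : ¬ p ∣ b) (hrn : r ≤ n) {x : Fin n → L}
    (hσx : ∀ i j, σ i (x j) = x j + if i = j then 1 else 0)
    (hgen : ∀ j : Fin n, r ≤ j → ∃ c : Fin n → F, c j = 1 ∧ (∀ i, j < i → c i = 0) ∧
      ∃ κ ∈ stage σ r, vL (∑ i, algebraMap F L (c i) * x i - κ) =
        ((-((p : ℤ) ^ (n - (j + 1)) * b) : ℤ) : WithTop ℤ)) :
    ∃ (lam : ℤ → L) (Ψ : Fin (n - r) → MonoidAlgebra F Gal(L/stage σ r)),
      IsGaloisScaffold p b (n - r) vL lam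
        (fun i => MonoidAlgebra.mapRingHom Gal(L/stage σ r) (algebraMap F (stage σ r)) (Ψ i)) ∧
      ∀ i, InTruncSpan p p F Gal(L/stage σ r)
        (Ideal.Quotient.mk (augIdeal F Gal(L/stage σ r) ^ p) (1 + Ψ i)) := by
  have : IsScalarTower F (stage σ r) L := IsScalarTower.of_algebraMap_eq fun _ => rfl
  let idx : Fin (n - r) → Fin n := fun l => ⟨r + l, by omega⟩
  choose c hc1 hc2 κ hκ hv using fun l : Fin (n - r) => hgen (idx l) (Nat.le_add_right r l)
  have hmem : ∀ i : Fin (n - r), σ (idx i) ∈ (stage σ r).fixingSubgroup := fun i =>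
    (IntermediateField.mem_fixingSubgroup_iff _ _).2 fun z hz =>
      mem_stage.1 hz _ (Nat.le_add_right r i)
  refine exists_scaffold hF hb hpb ?_ (X := fun l => ∑ i, algebraMap F L (c l i) * x i - κ l) ?_
    (fun i l => c l (idx i))
    (fun i => IntermediateField.fixingSubgroupEquiv (stage σ r) ⟨σ (idx i), hmem i⟩) ?_ hc1 ?_
  · intro k
    obtain ⟨t, ht, hvt⟩ := h.exists_mem_stage hrn k
    exact ⟨⟨t, ht⟩, hvt⟩
  · intro l
    refine val_eq_congr vL (hv l) ?_
    rw [show n - (((idx l : Fin n) : ℕ) + 1) = n - r - 1 - (l : ℕ) by simp only [idx]; omega]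
  · intro i l
    change σ (idx i) _ = _
    rw [map_sub, mem_stage.1 (hκ l) _ (Nat.le_add_right r i), map_sum]
    simp only [map_mul, fixed_const, hσx, mul_add, Finset.sum_add_distrib, mul_ite, mul_one,
      mul_zero, Finset.sum_ite_eq, Finset.mem_univ, if_true]
    ring
  · intro i l hli
    refine hc2 l (idx i) ?_
    rw [Fin.lt_def] at hli ⊢
    simp only [idx]
    omega

end Construction

end AS

theorem mainTheorem4 (p : ℕ) [Fact p.Prime] (n r b : ℕ) (hb : 0 < b)
    (hr : 1 ≤ r) (hrn : r ≤ n - 1)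
    {F K L : Type*} [Field F] [Field K] [Field L] [CharP K p] [PerfectField F]
    [Algebra (ZMod p) F] [Algebra F K] [Algebra K L] [FiniteDimensional K L] [IsGalois K L]
    (vK : AddValuation K (WithTop ℤ)) (hK : AS.IsLocalField F vK)
    (vL : AddValuation L (WithTop ℤ)) (hL : AS.IsTotallyRamified vK vL)
    (hG : Nonempty (Gal(L/K) ≃* Multiplicative (Fin n → ZMod p)))
    (hbreak : AS.ramificationBreaks K vL = {(b : ℤ)})
    (β : K) (ω : Fin n → F) (ε : Fin n → K)
    (hdata : AS.IsArtinSchreierData p b L vK β ω ε)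
    (hε : ∀ i, ((-(b : ℤ) : ℤ) : WithTop ℤ) < p ^ (n - 1 - r) • vK (ε i))
    (x : Fin n → L)
    (hx : ∀ i : Fin n, (i : ℕ) < r →
      x i ^ p - x i = algebraMap K L (AS.asConst p β ω ε i))
    (Kr : IntermediateField K L)
    (hKr : Kr = IntermediateField.adjoin K (x '' {i : Fin n | (i : ℕ) < r})) :
    ∃ (lam : ℤ → L) (Ψ : Fin (n - r) → MonoidAlgebra F Gal(L/Kr)),
      AS.IsGaloisScaffold p b (n - r) vL lam
        (fun i => MonoidAlgebra.mapRingHom Gal(L/Kr)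
          ((algebraMap K Kr).comp (algebraMap F K)) (Ψ i)) ∧
      ∀ i, AS.InTruncSpan p p F Gal(L/Kr)
        (Ideal.Quotient.mk (AS.augIdeal F Gal(L/Kr) ^ p) (1 + Ψ i)) := by
  let _ : Algebra F L := ((algebraMap K L).comp (algebraMap F K)).toAlgebra
  have : IsScalarTower F K L := IsScalarTower.of_algebraMap_eq fun _ => rfl
  have : CharP L p := charP_of_injective_algebraMap (algebraMap K L).injective p
  have : CharP F p := (Algebra.charP_iff F K p).2 inferInstance
  have hperf : ∀ c : F, ∃ d : F, d ^ p = c := by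
    have : ExpChar F p := ExpChar.prime Fact.out
    have : PerfectRing F p := PerfectField.toPerfectRing p
    exact surjective_frobenius F p
  have hcard : Nat.card Gal(L/K) = p ^ n := by
    obtain ⟨e⟩ := hG
    rw [Nat.card_congr e.toEquiv, Nat.card_congr Multiplicative.toAdd]
    simp
  have hN : Module.finrank K L = p ^ n := by rw [← IsGalois.card_aut_eq_finrank, hcard]
  obtain ⟨x', hx', hgen⟩ := hdata.generates
  -- the given generators are completed to a full set of generators
  set y : Fin n → L := fun i => if (i : ℕ) < r then x i else x' i with hy
  have hyx : ∀ i : Fin n, (i : ℕ) < r → y i = x i := fun i hi => if_pos hi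
  have hyeq : ∀ i, y i ^ p - y i = algebraMap K L (AS.asConst p β ω ε i) := by
    intro i
    by_cases hi : (i : ℕ) < r
    · rw [hyx i hi, hx i hi]
    · rw [show y i = x' i from if_neg hi, hx' i]
  obtain ⟨σ, hσy, hσfix⟩ := AS.exists_dual_automorphisms hyeq
    (AS.adjoin_exchange hyeq hx' hgen) hcard
  have htower : AS.IsTower p vL σ := AS.isTower hK hL hG hN fun τ =>
    hσfix τ 0 fun j hj => absurd hj (Nat.not_lt_zero _)
  have hpb : ¬ p ∣ b := by
    refine AS.not_dvd_break (σ := σ ⟨0, by omega⟩) hK hL hbreak hN ?_ (htower.pow _)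
    intro h1
    have h2 := hσy ⟨0, by omega⟩ ⟨0, by omega⟩
    rw [h1, if_pos rfl] at h2
    simp at h2
  have hstage : Kr = AS.stage σ r := by
    refine le_antisymm ?_ fun z hz => ?_
    · rw [hKr, IntermediateField.adjoin_le_iff]
      rintro _ ⟨j, hj, rfl⟩
      refine AS.mem_stage.2 fun i hi => ?_
      have hj' : (j : ℕ) < r := hj
      rw [← hyx j hj', hσy, if_neg (fun h => by subst h; omega), add_zero]
    · rw [← IsGalois.fixedField_fixingSubgroup Kr, IntermediateField.mem_fixedField_iff]
      intro τ hτ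
      refine hσfix τ r (fun j hj => ?_) z hz
      refine (IntermediateField.mem_fixingSubgroup_iff _ _).1 hτ _ ?_
      rw [hyx j hj, hKr]
      exact IntermediateField.subset_adjoin K _ ⟨j, hj, rfl⟩
  clear hKr
  subst hstage
  exact AS.exists_scaffold_stage (hL.isConstField hK) htower hb hpb (by omega) hσy
    (AS.exists_all_generators hK hL hbreak hN htower hperf hb hpb hdata.linearIndependent
      hdata.val_beta hε hyeq hσy)
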